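/- Let $n,l\in\mathbb N$, $a_{m,i}\in\mathbb R$, $b_{ij}\ge 0$ ($i,j\in\{1,\dots,n\}$, $1\le m\le l$), $\Delta t>0$, and consider the network dynamics $$\sum_{m=1}^{l}a_{m,i}\frac{d^m x_i}{dt^m}=\sum_{j\ne i}b_{ij}\,(x_j-x_i)+p_i,\qquad i=1,\dots,n,$$ discretized by the bilinear transform with sampling time $\Delta t$, that is $$S_i(z)X_i(z)=\sum_{j\neq i}b_{ij}X_j(z)+P_i(z),\qquad S_i(z)=\sum_{m=1}^{l}a_{m,i}\Big(\frac{2(1-z^{-1})}{\Delta t(1+z^{-1})}\Big)^m+\sum_{j\ne i}b_{ij},$$ understood, after multiplication by $(1+z^{-1})^l$, as a difference equation with $z^{-1}$ acting as the backward shift. Here $p_1,\dots,p_n$ are real, zero-mean, wide sense stationary sequences, mutually uncorrelated, with absolutely summable correlations and with power spectral densities $\Phi_{p_i}$ (where $\Phi_{p_i}(\omega)=\sum_{k\in\mathbb Z}\mathbb E(p_i(k)p_i(0))e^{-\mathrm i\omega k}$) that are positive at almost every frequency, and $x=(x_1,\dots,x_n)$ is a jointly wide sense stationary sequence with absolutely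 summable correlations that satisfies the equations. Let $H_{ij}=b_{ij}/S_i$ for $i\ne j$, $H_{ii}=0$. The set of parents of $j$ is $P_j=\{i: H_{ji}\not\equiv 0\}$, the set of children of $j$ is $C_j=\{i: H_{ij}\not\equiv 0\}$, and $\mathcal N_j=P_j\cup C_j$ is the set of neighbors of $j$. Fix $j$, and let $\hat x_j(k)$ be the non-causal Wiener estimate of $x_j(k)$, that is, the minimizer of $\mathbb E(x_j(k)-q)^2$ over $q$ in the mean-square closed linear span of $\{x_i(t): i\ne j,\ t\in\mathbb Z\}$. Then there are filters $W_{ji}$, $i\neq j$, with $\hat X_j(z)=\sum_{i\ne j}W_{ji}(z)X_i(z)$ (that is, $\hat x_j$ is the output of $(W_{ji})_{i\ne j}$ driven by $(x_i)_{i\neq j}$), and any such filters satisfy, for all $i\ne j$ and almost every $z=e^{\mathrm i\omega}$, $$W_{ji}(z)=\hat C_{ji}(z)+\hat P_{ji}(z)+\hat K_{ji}(z),$$ where, with $\Delta_j(z)=|S_j(z)|^2\Phi_{p_j}^{-1}(z)+\sum_{l\in\mathcal N_j}b_{lj}^2\Phi_{p_l}^{-1}(z)$, $$\hat C_{ji}=\frac{b_{ij}S_i\Phi_{p_i}^{-1}}{\Delta_j},\qquad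 \hat P_{ji}=\frac{b_{ji}S_j^{*}\Phi_{p_j}^{-1}}{\Delta_j},\qquad \hat K_{ji}=-\frac{\sum_{k\in\mathcal N_i\cap\mathcal N_j}b_{kj}b_{ki}\Phi_{p_k}^{-1}}{\Delta_j}.$$ The denominator $\Delta_j(z)$ is real and positive for almost every $z$ on the unit circle. If every child of $j$ is also a parent of $j$ (in particular if the network is bi-directed), the sum in $\Delta_j$ may be taken over $P_j$ instead of $\mathcal N_j$. -/

import Mathlib

open MeasureTheory Filter Topology Real

noncomputable section

namespace WienerNet

/-! ### Second-order processes in discrete time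

A real second-order random sequence is a map `ℤ → Lp ℝ 2 μ`: square-integrable random variables,
identified when they agree almost surely. -/

section Processes

variable {Ω : Type*} [MeasurableSpace Ω] (μ : Measure Ω) {ι : Type*}

/-- The family `(x_i)` is jointly wide sense stationary: constant means, and second moments
invariant under a common time shift. -/
def JointlyWSS (x : ι → ℤ → Lp ℝ 2 μ) : Prop :=
  (∀ i s t, ∫ w, x i s w ∂μ = ∫ w, x i t w ∂μ) ∧
    ∀ i j s t u, ∫ w, x i (s + u) w * x j (t + u) w ∂μ = ∫ w, x i s w * x j t w ∂μ

/-- The entry `E (x_i(k) x_j(0))` of the correlation matrix at lag `k`. -/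
def corr (x : ι → ℤ → Lp ℝ 2 μ) (i j : ι) (k : ℤ) : ℝ :=
  ∫ w, x i k w * x j 0 w ∂μ

/-- The correlations are absolutely summable, so that the series defining the power spectral
density matrix converges. -/
def SummableCorr (x : ι → ℤ → Lp ℝ 2 μ) : Prop :=
  ∀ i j, Summable (corr μ x i j)

/-- The power spectral density matrix
`Φ_x(ω) = ∑_{k ∈ ℤ} E (x(k) x(0)ᵀ) exp (- i ω k)`. -/
def psd (x : ι → ℤ → Lp ℝ 2 μ) (ω : ℝ) : Matrix ι ι ℂ :=
  Matrix.of fun i j =>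
    ∑' k : ℤ, (corr μ x i j k : ℂ) * Complex.exp (-(Complex.I * (ω : ℂ) * (k : ℂ)))

/-- The output at time `k` of the (non-causal) finite impulse response filter with real taps
`h_i(L)`, that is `∑_i ∑_L h_i(L) x_i(k - L)`. -/
def firOutput [Fintype ι] (x : ι → ℤ → Lp ℝ 2 μ) (h : ι → ℤ →₀ ℝ) (k : ℤ) : Lp ℝ 2 μ :=
  ∑ i, (h i).sum fun L c => c • x i (k - L)

/-- The frequency response `∑_L h_i(L) z^{-L}`, `z = exp (i ω)`, of such a filter. -/
def firResponse (h : ι → ℤ →₀ ℝ) (i : ι) (ω : ℝ) : ℂ :=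
  (h i).sum fun L c => (c : ℂ) * Complex.exp (-(Complex.I * (ω : ℂ) * (L : ℂ)))

/-- The squared distance `∫ (V - W) Φ_x (V - W)^* dω` (over one period) of two frequency responses
in the spectral space `L²(Φ_x)`; the integrand is real and nonnegative. -/
def spectralDistSq [Fintype ι] (x : ι → ℤ → Lp ℝ 2 μ) (V W : ι → ℝ → ℂ) : ENNReal :=
  ∫⁻ ω in Set.Ioc (-π) π, ENNReal.ofReal
    (∑ i, ∑ l, (V i ω - W i ω) * psd μ x ω i l * (starRingEnd ℂ) (V l ω - W l ω)).re

/-- `Y(z) = ∑_i W_i(z) X_i(z)`: the sequence `y` is the output of the linear time invariant filter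
with frequency response `W` driven by the stationary sequences `x_i`. As usual this means that
the filter is the limit in `L²(Φ_x)` of finite impulse response filters whose outputs converge to
`y` in mean square. -/
def IsFilterOutput [Fintype ι] (x : ι → ℤ → Lp ℝ 2 μ) (W : ι → ℝ → ℂ) (y : ℤ → Lp ℝ 2 μ) : Prop :=
  (∀ i, AEMeasurable (W i) (volume.restrict (Set.Ioc (-π) π))) ∧
    ∃ h : ℕ → ι → ℤ →₀ ℝ,
      Tendsto (fun m => spectralDistSq μ x (firResponse (h m)) W) atTop (𝓝 0) ∧
        ∀ k, Tendsto (fun m => firOutput μ x (h m) k) atTop (𝓝 (y k))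

/-- The observed space of `j`: the closed linear span in mean square of all
`x_i(k)`, `i ≠ j`, `k ∈ ℤ`. -/
def observedSpace (x : ι → ℤ → Lp ℝ 2 μ) (j : ι) : Submodule ℝ (Lp ℝ 2 μ) :=
  (Submodule.span ℝ {v | ∃ i, i ≠ j ∧ ∃ k, v = x i k}).topologicalClosure

/-- `y(k)` is the non-causal least squares estimate of `x_j(k)` from the other sequences: it lies
in the observed space and minimizes `E (x_j(k) - q)²` there. -/
def IsWienerEstimate (x : ι → ℤ → Lp ℝ 2 μ) (j : ι) (y : ℤ → Lp ℝ 2 μ) : Prop :=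
  ∀ k, y k ∈ observedSpace μ x j ∧
    ∀ q ∈ observedSpace μ x j,
      ∫ w, (x j k w - y k w) ^ 2 ∂μ ≤ ∫ w, (x j k w - q w) ^ 2 ∂μ

/-- `W = (W_{ji})_{i ≠ j}` (as functions of the frequency `ω`, `z = exp (i ω)`) is the
multivariate non-causal Wiener filter of `j`: the least squares estimate is the filter output
`∑_{i ≠ j} W_{ji}(z) X_i(z)`. -/
def IsWienerFilter [Fintype ι] [DecidableEq ι] (x : ι → ℤ → Lp ℝ 2 μ) (j : ι)
    (W : {i : ι // i ≠ j} → ℝ → ℂ) : Prop :=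
  ∃ y : ℤ → Lp ℝ 2 μ, IsWienerEstimate μ x j y ∧
    IsFilterOutput μ (fun i : {i : ι // i ≠ j} => x i.1) W y

end Processes

/-- The backward shift `(B f)(k) = f(k - 1)` on sequences. -/
def backshift (E : Type*) [AddCommGroup E] [Module ℝ E] : Module.End ℝ (ℤ → E) where
  toFun f k := f (k - 1)
  map_add' _ _ := rfl
  map_smul' _ _ := rfl

/-! ### The network -/

/-- Parameters of the network dynamics
`∑_{m=1}^{order} a_{m,i} d^m x_i / dt^m = ∑_{j ≠ i} b_{ij} (x_j - x_i) + p_i`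
and the sampling time `dt`. The numbers `b_{ii}` play no role. -/
structure Network (n : ℕ) where
  order : ℕ
  a : ℕ → Fin n → ℝ
  b : Fin n → Fin n → ℝ
  dt : ℝ
  b_nonneg : ∀ i j, 0 ≤ b i j
  dt_pos : 0 < dt

namespace Network

variable {n : ℕ} (D : Network n)

/-- `S_i(z)`, obtained through the bilinear substitution
`d/dt ↦ 2 (1 - z⁻¹) / (dt (1 + z⁻¹))`. -/
def S (i : Fin n) (z : ℂ) : ℂ :=
  ∑ m ∈ Finset.Icc 1 D.order,
      (D.a m i : ℂ) * (2 * (1 - z⁻¹) / ((D.dt : ℂ) * (1 + z⁻¹))) ^ m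
    + ∑ j ∈ Finset.univ.erase i, (D.b i j : ℂ)

/-- The transfer functions `H_{ij}(z) = b_{ij} / S_i(z)` for `i ≠ j`, and `H_{ii} = 0`. -/
def H (i j : Fin n) (z : ℂ) : ℂ :=
  if i = j then 0 else (D.b i j : ℂ) / D.S i z

/-- The parents of `j` in the generative graph: the `i` with `H_{ji}` not identically zero. -/
def parents (j : Fin n) : Finset (Fin n) := by
  classical exact Finset.univ.filter fun i => D.H j i ≠ 0

/-- The children of `j` in the generative graph: the `i` with `H_{ij}` not identically zero. -/
def children (j : Fin n) : Finset (Fin n) := by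
  classical exact Finset.univ.filter fun i => D.H i j ≠ 0

/-- The topology: the undirected graph underlying the generative graph. -/
def topology : SimpleGraph (Fin n) :=
  SimpleGraph.fromRel fun i j => D.H i j ≠ 0

/-- The neighbors of `j` in the topology. -/
def neighbors (j : Fin n) : Finset (Fin n) := by
  classical exact Finset.univ.filter fun i => D.topology.Adj j i

/-- The sequences `x`, driven by `p`, satisfy the bilinear discretization
`S_i(z) X_i(z) = ∑_{j ≠ i} b_{ij} X_j(z) + P_i(z)` of the dynamics; as a difference equation, with
`z⁻¹` acting as the backward shift `B`, and both sides multiplied by `(1 + z⁻¹)^order`. -/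
def Satisfies {E : Type*} [AddCommGroup E] [Module ℝ E] (x p : Fin n → ℤ → E) : Prop :=
  ∀ i, ∑ m ∈ Finset.Icc 1 D.order, (D.a m i * (2 / D.dt) ^ m) •
        ((1 - backshift E) ^ m * (1 + backshift E) ^ (D.order - m)) (x i)
      + (∑ j ∈ Finset.univ.erase i, D.b i j) • ((1 + backshift E) ^ D.order) (x i)
    = ((1 + backshift E) ^ D.order) (∑ j ∈ Finset.univ.erase i, D.b i j • x j + p i)

section Terms

variable {Ω : Type*} [MeasurableSpace Ω] (μ : Measure Ω) (p : Fin n → ℤ → Lp ℝ 2 μ)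

/-- `|S_j(z)|² Φ_{p_j}(z)⁻¹ + ∑_{l ∈ T} b_{lj}² Φ_{p_l}(z)⁻¹` at `z = exp (i ω)`. -/
def denom (T : Finset (Fin n)) (j : Fin n) (ω : ℝ) : ℂ :=
  ((‖D.S j (Complex.exp (Complex.I * ω))‖ ^ 2 : ℝ) : ℂ) * (psd μ p ω j j)⁻¹
    + ∑ l ∈ T, (D.b l j : ℂ) ^ 2 * (psd μ p ω l l)⁻¹

/-- The child term `Ĉ_{ji}` at `z = exp (i ω)`. -/
def childTerm (j i : Fin n) (ω : ℝ) : ℂ :=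
  (D.b i j : ℂ) * D.S i (Complex.exp (Complex.I * ω)) * (psd μ p ω i i)⁻¹
    / D.denom μ p (D.neighbors j) j ω

/-- The parent term `P̂_{ji}` at `z = exp (i ω)`. -/
def parentTerm (j i : Fin n) (ω : ℝ) : ℂ :=
  (D.b j i : ℂ) * (starRingEnd ℂ) (D.S j (Complex.exp (Complex.I * ω))) * (psd μ p ω j j)⁻¹
    / D.denom μ p (D.neighbors j) j ω

/-- The spouse term `K̂_{ji}` at `z = exp (i ω)`: a sum over the common neighbors of `i`
and `j`. -/
def spouseTerm (j i : Fin n) (ω : ℝ) : ℂ :=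
  -((∑ k ∈ D.neighbors i ∩ D.neighbors j,
      (D.b k j : ℂ) * (D.b k i : ℂ) * (psd μ p ω k k)⁻¹)
    / D.denom μ p (D.neighbors j) j ω)

end Terms

end Network

end WienerNet

end

/-! Let M(z) = diag(S_i) - (b_ij). On cross spectra a difference operator acts as multiplication by
its symbol, so the dynamics become the factorization M Φ_x M* = diag(Φ_p) at every frequency where 1
+ z⁻¹ ≠ 0 (`Satisfies.factor`). The densities Φ_p are positive almost everywhere, so M is invertible
there, and Φ_x is positive definite with inverse M* diag(Φ_p)⁻¹ M.

A filter V for the j-th sequence has error spectrum U Φ_x U*, where U is 1 at j and -V elsewhere.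
Completing the square under U_j = 1 (`sesq_eq_add_of_factor`) gives (U - R) Φ_x (U - R)* + 1/θ,
where θ is the (j,j) entry of Φ_x⁻¹ and R is its j-th row divided by θ. Since M has entries S_i and
-b_ij, expanding M* diag(Φ_p)⁻¹ M shows that θ is Δ_j and that -R_i is the sum F_i of the child,
parent and spouse terms (`factorDiag_dynMatrix`, `factorRow_dynMatrix`).

The rest moves this pointwise minimum to the processes. Finite filters map isometrically, up to 2π,
into the spectral space, so the error of a finite filter is its squared spectral distance to F plus
the fixed constant ∫ 1/θ (`ofReal_error_eq`). Real finite filters approximate F, because F is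
conjugate symmetric and at finite distance from 0 (`exists_fir_tendsto`). Hence the constant is the
least error, the outputs of the approximants converge to the projection, and F is a Wiener filter.
Any other Wiener filter is at spectral distance 0 from F, and definiteness of the spectrum makes the
two equal almost everywhere. -/

noncomputable section

namespace WienerNet

/-! ### Cross spectra of jointly stationary sequences in a real Hilbert space -/

section CrossSpectra

variable {E : Type*} [NormedAddCommGroup E] [InnerProductSpace ℝ E]

/-- Two sequences with shift-invariant inner products and absolutely summable cross
correlation. -/
structure Costationary (u v : ℤ → E) : Prop where
  shift : ∀ s t r, inner ℝ (u (s + r)) (v (t + r)) = inner ℝ (u s) (v t)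
  summable : Summable fun k : ℤ => inner ℝ (u k) (v 0)

/-- The cross power spectral density of two sequences. -/
def crossSpectrum (u v : ℤ → E) (ω : ℝ) : ℂ :=
  ∑' k : ℤ, ((inner ℝ (u k) (v 0) : ℝ) : ℂ) * Complex.exp (-(Complex.I * (ω : ℂ) * (k : ℂ)))

lemma norm_exp_neg_I_mul_mul_int (ω : ℝ) (k : ℤ) :
    ‖Complex.exp (-(Complex.I * (ω : ℂ) * (k : ℂ)))‖ = 1 := by
  have : -(Complex.I * (ω : ℂ) * (k : ℂ)) = ((-(ω * k) : ℝ) : ℂ) * Complex.I := by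
    push_cast; ring
  rw [this, Complex.norm_exp_ofReal_mul_I]

lemma norm_ofReal_mul_exp (c ω : ℝ) (k : ℤ) :
    ‖(c : ℂ) * Complex.exp (-(Complex.I * (ω : ℂ) * (k : ℂ)))‖ = ‖c‖ := by
  rw [norm_mul, norm_exp_neg_I_mul_mul_int, mul_one, Complex.norm_real]

lemma conj_exp_neg_I_mul_mul_int (ω : ℝ) (k : ℤ) :
    (starRingEnd ℂ) (Complex.exp (-(Complex.I * (ω : ℂ) * (k : ℂ)))) =
      Complex.exp (-(Complex.I * (ω : ℂ) * ((-k : ℤ) : ℂ))) := by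
  rw [← Complex.exp_conj]
  congr 1
  simp

namespace Costationary

variable {u u' v : ℤ → E}

lemma summable_terms (h : Costationary u v) (ω : ℝ) :
    Summable fun k : ℤ =>
      ((inner ℝ (u k) (v 0) : ℝ) : ℂ) * Complex.exp (-(Complex.I * (ω : ℂ) * (k : ℂ))) := by
  refine Summable.of_norm ?_
  simpa only [norm_ofReal_mul_exp] using h.summable.norm

lemma inner_neg (h : Costationary u v) (k : ℤ) :
    inner ℝ (v k) (u 0) = inner ℝ (u (-k)) (v 0) := by
  rw [real_inner_comm, ← h.shift 0 k (-k)]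
  simp

lemma symm (h : Costationary u v) : Costationary v u := by
  refine ⟨fun s t r => ?_, ?_⟩
  · rw [real_inner_comm, h.shift, real_inner_comm]
  · simp only [h.inner_neg]
    exact (Equiv.neg ℤ).summable_iff.2 h.summable

lemma crossSpectrum_symm (h : Costationary u v) (ω : ℝ) :
    crossSpectrum v u ω = (starRingEnd ℂ) (crossSpectrum u v ω) := by
  rw [crossSpectrum, crossSpectrum, Complex.conj_tsum, ← (Equiv.neg ℤ).tsum_eq]
  refine tsum_congr fun k => ?_
  rw [map_mul, conj_exp_neg_I_mul_mul_int, Equiv.neg_apply, h.inner_neg, neg_neg,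
    Complex.conj_ofReal]

lemma add_left (h : Costationary u v) (h' : Costationary u' v) : Costationary (u + u') v := by
  refine ⟨fun s t r => ?_, ?_⟩
  · simp only [Pi.add_apply, inner_add_left, h.shift, h'.shift]
  · simpa only [Pi.add_apply, inner_add_left] using h.summable.add h'.summable

lemma crossSpectrum_add_left (h : Costationary u v) (h' : Costationary u' v) (ω : ℝ) :
    crossSpectrum (u + u') v ω = crossSpectrum u v ω + crossSpectrum u' v ω := by
  rw [crossSpectrum, crossSpectrum, crossSpectrum,
    ← (h.summable_terms ω).tsum_add (h'.summable_terms ω)]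
  refine tsum_congr fun k => ?_
  rw [Pi.add_apply, inner_add_left, Complex.ofReal_add, add_mul]

lemma smul_left (h : Costationary u v) (c : ℝ) : Costationary (c • u) v := by
  refine ⟨fun s t r => ?_, ?_⟩
  · simp only [Pi.smul_apply, real_inner_smul_left, h.shift]
  · simpa only [Pi.smul_apply, real_inner_smul_left] using h.summable.mul_left c

end Costationary

lemma crossSpectrum_smul_left (u v : ℤ → E) (c : ℝ) (ω : ℝ) :
    crossSpectrum (c • u) v ω = c * crossSpectrum u v ω := by
  rw [crossSpectrum, crossSpectrum, ← tsum_mul_left]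
  refine tsum_congr fun k => ?_
  rw [Pi.smul_apply, real_inner_smul_left, Complex.ofReal_mul, mul_assoc]

lemma Costationary.zero_left (v : ℤ → E) : Costationary 0 v :=
  ⟨fun s t r => by simp, by simp⟩

lemma crossSpectrum_zero_left (v : ℤ → E) (ω : ℝ) : crossSpectrum 0 v ω = 0 := by
  simp [crossSpectrum]

lemma Costationary.sum_left {κ : Type*} {s : Finset κ} {u : κ → ℤ → E} {v : ℤ → E}
    (h : ∀ i ∈ s, Costationary (u i) v) :
    Costationary (∑ i ∈ s, u i) v ∧
      ∀ ω, crossSpectrum (∑ i ∈ s, u i) v ω = ∑ i ∈ s, crossSpectrum (u i) v ω := by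
  classical
  induction s using Finset.induction_on with
  | empty => exact ⟨by simpa using zero_left v, fun ω => by simpa using crossSpectrum_zero_left v ω⟩
  | insert a s ha ih =>
    have h1 := ih fun i hi => h i (Finset.mem_insert_of_mem hi)
    have h2 := h a (Finset.mem_insert_self a s)
    rw [Finset.sum_insert ha]
    exact ⟨h2.add_left h1.1, fun ω => by
      rw [h2.crossSpectrum_add_left h1.1, h1.2, Finset.sum_insert ha]⟩

lemma Costationary.translate_left {u v : ℤ → E} (h : Costationary u v) (L : ℤ) :
    Costationary (fun k => u (k - L)) v := by
  refine ⟨fun s t r => ?_, ?_⟩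
  · have := h.shift (s - L) t r
    rwa [sub_add_eq_add_sub] at this
  · exact (Equiv.subRight L).summable_iff.2 h.summable

lemma crossSpectrum_translate_left (u v : ℤ → E) (L : ℤ) (ω : ℝ) :
    crossSpectrum (fun k => u (k - L)) v ω =
      Complex.exp (-(Complex.I * (ω : ℂ) * (L : ℂ))) * crossSpectrum u v ω := by
  rw [crossSpectrum, crossSpectrum, ← tsum_mul_left, ← (Equiv.addRight L).tsum_eq]
  refine tsum_congr fun k => ?_
  rw [Equiv.coe_addRight, add_sub_cancel_right, mul_left_comm, ← Complex.exp_add]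
  congr 2
  push_cast
  ring

lemma continuous_exp_neg_I_mul_mul_int (k : ℤ) :
    Continuous fun ω : ℝ => Complex.exp (-(Complex.I * (ω : ℂ) * (k : ℂ))) := by
  fun_prop

lemma Costationary.continuous_crossSpectrum {u v : ℤ → E} (h : Costationary u v) :
    Continuous (crossSpectrum u v) := by
  refine continuous_tsum (fun k => ?_) h.summable.norm fun k ω => ?_
  · exact continuous_const.mul (continuous_exp_neg_I_mul_mul_int k)
  · rw [norm_ofReal_mul_exp]

lemma integral_exp_neg_I_mul_mul_int (k : ℤ) :
    ∫ ω in Set.Ioc (-π) π, Complex.exp (-(Complex.I * (ω : ℂ) * (k : ℂ))) =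
      if k = 0 then ((2 * π : ℝ) : ℂ) else 0 := by
  split_ifs with hk
  · subst hk
    simp only [Int.cast_zero, mul_zero, neg_zero, Complex.exp_zero]
    rw [setIntegral_const, measureReal_def, Real.volume_Ioc, ENNReal.toReal_ofReal (by linarith [pi_pos])]
    simp; ring
  · rw [← intervalIntegral.integral_of_le (by linarith [pi_pos])]
    have hc : (-(Complex.I * k) : ℂ) ≠ 0 := by simpa using hk
    have := integral_exp_mul_complex (a := -π) (b := π) hc
    rw [show (fun ω : ℝ => Complex.exp (-(Complex.I * (ω : ℂ) * (k : ℂ)))) =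
      fun ω : ℝ => Complex.exp (-(Complex.I * k) * ω) from by ext; ring_nf]
    rw [this, div_eq_zero_iff]
    left
    rw [sub_eq_zero, Complex.exp_eq_exp_iff_exists_int]
    exact ⟨-k, by push_cast; ring⟩

/-- Inversion formula at lag zero. -/
lemma Costationary.integral_crossSpectrum {u v : ℤ → E} (h : Costationary u v) :
    ∫ ω in Set.Ioc (-π) π, crossSpectrum u v ω = ((2 * π * inner ℝ (u 0) (v 0) : ℝ) : ℂ) := by
  -- Termwise integration is legitimate because the norm of each term is constant in ω and these
  -- norms are summable; only lag 0 survives.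
  have key := hasSum_integral_of_summable_integral_norm
    (μ := volume.restrict (Set.Ioc (-π) π))
    (F := fun (k : ℤ) (ω : ℝ) =>
      ((inner ℝ (u k) (v 0) : ℝ) : ℂ) * Complex.exp (-(Complex.I * (ω : ℂ) * (k : ℂ))))
    (fun k => ((continuous_const.mul
      (continuous_exp_neg_I_mul_mul_int k)).integrableOn_Icc).mono_set Set.Ioc_subset_Icc_self)
    (by
      simp only [norm_ofReal_mul_exp, integral_const]
      exact h.summable.norm.const_smul _)
  simp only [integral_const_mul, integral_exp_neg_I_mul_mul_int] at key
  have h0 := hasSum_ite_eq (0 : ℤ) (((inner ℝ (u 0) (v 0) : ℝ) : ℂ) * ((2 * π : ℝ) : ℂ))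
  rw [show (∫ ω in Set.Ioc (-π) π, crossSpectrum u v ω) = _ from key.unique (h0.congr_fun fun k => ?_)]
  · push_cast; ring
  · split_ifs with hk
    · rw [hk]
    · simp

/-! ### Linear filters acting on sequences -/

/-- The operator `T` on sequences multiplies cross spectra at frequency `ω` by `τ`. -/
def HasSymbolAt (T : Module.End ℝ (ℤ → E)) (ω : ℝ) (τ : ℂ) : Prop :=
  ∀ u v : ℤ → E, Costationary u v →
    Costationary (T u) v ∧ crossSpectrum (T u) v ω = τ * crossSpectrum u v ω

namespace HasSymbolAt

variable {T T' : Module.End ℝ (ℤ → E)} {ω : ℝ} {τ τ' : ℂ}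

lemma one : HasSymbolAt (1 : Module.End ℝ (ℤ → E)) ω 1 :=
  fun u v h => ⟨h, by simp⟩

lemma add (h : HasSymbolAt T ω τ) (h' : HasSymbolAt T' ω τ') : HasSymbolAt (T + T') ω (τ + τ') :=
  fun u v huv => ⟨(h u v huv).1.add_left (h' u v huv).1, by
    rw [LinearMap.add_apply, (h u v huv).1.crossSpectrum_add_left (h' u v huv).1, (h u v huv).2,
      (h' u v huv).2, add_mul]⟩

lemma smul (h : HasSymbolAt T ω τ) (c : ℝ) : HasSymbolAt (c • T) ω (c * τ) :=
  fun u v huv => ⟨(h u v huv).1.smul_left c, by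
    rw [LinearMap.smul_apply, crossSpectrum_smul_left, (h u v huv).2, mul_assoc]⟩

lemma sub (h : HasSymbolAt T ω τ) (h' : HasSymbolAt T' ω τ') : HasSymbolAt (T - T') ω (τ - τ') := by
  have := h.add (h'.smul (-1))
  convert this using 1
  · ext u k
    simp [sub_eq_add_neg]
  · push_cast; ring

/-- Composition works because `HasSymbolAt` also asserts that costationarity is preserved, so the
outer symbol applies to the output of the inner operator. -/
lemma mul (h : HasSymbolAt T ω τ) (h' : HasSymbolAt T' ω τ') : HasSymbolAt (T * T') ω (τ * τ') :=
  fun u v huv => ⟨(h _ v (h' u v huv).1).1, by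
    rw [Module.End.mul_apply, (h _ v (h' u v huv).1).2, (h' u v huv).2, mul_assoc]⟩

lemma pow (h : HasSymbolAt T ω τ) (m : ℕ) : HasSymbolAt (T ^ m) ω (τ ^ m) := by
  induction m with
  | zero => simpa using one
  | succ m ih => simpa only [pow_succ] using ih.mul h

lemma sum {κ : Type*} {s : Finset κ} {T : κ → Module.End ℝ (ℤ → E)} {τ : κ → ℂ}
    (h : ∀ i ∈ s, HasSymbolAt (T i) ω (τ i)) : HasSymbolAt (∑ i ∈ s, T i) ω (∑ i ∈ s, τ i) := by
  classical
  induction s using Finset.induction_on with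
  | empty => exact fun u v _ => ⟨by simpa using Costationary.zero_left v,
      by simpa using crossSpectrum_zero_left v ω⟩
  | insert a s ha ih =>
    rw [Finset.sum_insert ha, Finset.sum_insert ha]
    exact (h a (Finset.mem_insert_self a s)).add (ih fun i hi => h i (Finset.mem_insert_of_mem hi))

lemma backshift (ω : ℝ) :
    HasSymbolAt (backshift E) ω (Complex.exp (-(Complex.I * (ω : ℂ)))) :=
  fun u v huv => ⟨huv.translate_left 1, by
    have h := crossSpectrum_translate_left u v 1 ω
    rw [Int.cast_one, mul_one] at h
    exact h⟩

end HasSymbolAt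

/-- Cross spectra of multi-input combinations `∑_i T_i u_i` and `∑_l T'_l u_l`. -/
lemma crossSpectrum_sum_sum {ι : Type*} {s s' : Finset ι} {u : ι → ℤ → E}
    (hu : ∀ i l, Costationary (u i) (u l)) {T T' : ι → Module.End ℝ (ℤ → E)}
    {ω : ℝ} {τ τ' : ι → ℂ}
    (hT : ∀ i ∈ s, HasSymbolAt (T i) ω (τ i)) (hT' : ∀ i ∈ s', HasSymbolAt (T' i) ω (τ' i)) :
    Costationary (∑ i ∈ s, T i (u i)) (∑ l ∈ s', T' l (u l)) ∧
      crossSpectrum (∑ i ∈ s, T i (u i)) (∑ l ∈ s', T' l (u l)) ω =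
        ∑ i ∈ s, ∑ l ∈ s', τ i * crossSpectrum (u i) (u l) ω *
          (starRingEnd ℂ) (τ' l) := by
  -- Symbols are defined through the left argument only; the right one is reached by Hermitian
  -- symmetry, which conjugates τ'.
  have right : ∀ i, Costationary (u i) (∑ l ∈ s', T' l (u l)) ∧
      crossSpectrum (u i) (∑ l ∈ s', T' l (u l)) ω =
        ∑ l ∈ s', crossSpectrum (u i) (u l) ω * (starRingEnd ℂ) (τ' l) := by
    intro i
    have h := Costationary.sum_left (s := s') (u := fun l => T' l (u l)) (v := u i)
      fun l hl => (hT' l hl _ _ (hu _ _)).1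
    refine ⟨h.1.symm, ?_⟩
    rw [h.1.crossSpectrum_symm, h.2, map_sum]
    refine Finset.sum_congr rfl fun l hl => ?_
    rw [(hT' l hl _ _ (hu _ _)).2, map_mul, mul_comm, ← (hu _ _).crossSpectrum_symm]
  have h := Costationary.sum_left (s := s) (u := fun i => T i (u i))
    (v := ∑ l ∈ s', T' l (u l)) fun i hi => (hT i hi _ _ (right _).1).1
  refine ⟨h.1, ?_⟩
  rw [h.2]
  refine Finset.sum_congr rfl fun i hi => ?_
  rw [(hT i hi _ _ (right _).1).2, (right _).2, Finset.mul_sum]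
  exact Finset.sum_congr rfl fun l _ => by ring

end CrossSpectra

/-! ### Hermitian forms with a spectral factorization -/

section Forms

variable {ι : Type*} [Fintype ι]

/-- The form `U Φ U^*` of a row vector `U`. -/
def sesq (Φ : Matrix ι ι ℂ) (U : ι → ℂ) : ℂ :=
  ∑ i, ∑ l, U i * Φ i l * (starRingEnd ℂ) (U l)

lemma sesq_eq_dotProduct (Φ : Matrix ι ι ℂ) (U : ι → ℂ) :
    sesq Φ U = dotProduct (Matrix.vecMul U Φ) (star U) := by
  simp only [sesq, dotProduct, Matrix.vecMul, Finset.sum_mul]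
  rw [Finset.sum_comm]
  rfl

lemma sesq_vecMul (Φ M : Matrix ι ι ℂ) (V : ι → ℂ) :
    sesq Φ (Matrix.vecMul V M) = sesq (M * Φ * M.conjTranspose) V := by
  rw [sesq_eq_dotProduct, sesq_eq_dotProduct, Matrix.star_vecMul, Matrix.dotProduct_mulVec]
  simp only [Matrix.vecMul_vecMul]

lemma sesq_diagonal [DecidableEq ι] (d V : ι → ℂ) :
    sesq (Matrix.diagonal d) V = ∑ i, d i * (V i * (starRingEnd ℂ) (V i)) := by
  refine Finset.sum_congr rfl fun i _ => ?_
  rw [Finset.sum_eq_single i]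
  · rw [Matrix.diagonal_apply_eq]; ring
  · intro l _ hl
    rw [Matrix.diagonal_apply_ne _ hl.symm]; ring
  · simp

lemma sesq_neg (Φ : Matrix ι ι ℂ) (U : ι → ℂ) : sesq Φ (-U) = sesq Φ U := by
  simp [sesq]

lemma sesq_add_add_sesq_sub (Φ : Matrix ι ι ℂ) (U V : ι → ℂ) :
    sesq Φ (U + V) + sesq Φ (U - V) = 2 * sesq Φ U + 2 * sesq Φ V := by
  simp only [sesq, Finset.mul_sum, ← Finset.sum_add_distrib]
  refine Finset.sum_congr rfl fun i _ => Finset.sum_congr rfl fun l _ => ?_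
  simp only [Pi.add_apply, Pi.sub_apply, map_add, map_sub]
  ring

/-- The parallelogram law with the nonnegative term in U - V dropped: a substitute for the triangle
inequality that avoids Cauchy–Schwarz. -/
lemma re_sesq_add_le {Φ : Matrix ι ι ℂ} (hΦ : ∀ U, 0 ≤ (sesq Φ U).re) (U V : ι → ℂ) :
    (sesq Φ (U + V)).re ≤ 2 * (sesq Φ U).re + 2 * (sesq Φ V).re := by
  have h := congrArg Complex.re (sesq_add_add_sesq_sub Φ U V)
  have h' := hΦ (U - V)
  simp only [Complex.add_re, Complex.mul_re, Complex.re_ofNat, Complex.im_ofNat, zero_mul,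
    sub_zero] at h
  linarith

/-- By AM–GM on each cross term. It lets ordinary mean square approximation control the spectral
distance when the spectrum is bounded. -/
lemma re_sesq_le {Φ : Matrix ι ι ℂ} {C : ℝ} (hC : ∀ i l, ‖Φ i l‖ ≤ C) (U : ι → ℂ) :
    (sesq Φ U).re ≤ C * Fintype.card ι * ∑ i, ‖U i‖ ^ 2 := by
  have hb : ∀ i l, (U i * Φ i l * (starRingEnd ℂ) (U l)).re ≤
      C / 2 * ‖U i‖ ^ 2 + C / 2 * ‖U l‖ ^ 2 := by
    intro i l
    refine (Complex.re_le_norm _).trans ?_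
    rw [norm_mul, norm_mul, RCLike.norm_conj]
    have h0 : 0 ≤ C := (norm_nonneg _).trans (hC i l)
    have h1 : ‖U i‖ * ‖Φ i l‖ * ‖U l‖ ≤ C * (‖U i‖ * ‖U l‖) := by
      calc _ = ‖Φ i l‖ * (‖U i‖ * ‖U l‖) := by ring
        _ ≤ _ := mul_le_mul_of_nonneg_right (hC i l) (by positivity)
    have h2 : ‖U i‖ * ‖U l‖ ≤ (‖U i‖ ^ 2 + ‖U l‖ ^ 2) / 2 := by
      linarith [two_mul_le_add_sq ‖U i‖ ‖U l‖]
    have := mul_le_mul_of_nonneg_left h2 h0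
    linarith
  simp only [sesq, Complex.re_sum]
  refine (Finset.sum_le_sum fun i _ => Finset.sum_le_sum fun l _ => hb i l).trans (le_of_eq ?_)
  simp only [Finset.sum_add_distrib, Finset.sum_const, Finset.card_univ, nsmul_eq_mul,
    ← Finset.mul_sum]
  ring

/-- The diagonal of `Mᴴ diag(d)⁻¹ M`. -/
def factorDiag (M : Matrix ι ι ℂ) (d : ι → ℝ) (j : ι) : ℝ := ∑ k, ‖M k j‖ ^ 2 / d k

/-- The `j`-th row of `Mᴴ diag(d)⁻¹ M`, divided by its diagonal entry. -/
def factorRow (M : Matrix ι ι ℂ) (d : ι → ℝ) (j : ι) (i : ι) : ℂ :=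
  (∑ k, (starRingEnd ℂ) (M k j) * M k i / d k) / factorDiag M d j

lemma sum_conj_mul_div_self (M : Matrix ι ι ℂ) (d : ι → ℝ) (j : ι) :
    ∑ k, (starRingEnd ℂ) (M k j) * M k j / d k = (factorDiag M d j : ℂ) := by
  rw [factorDiag]
  push_cast
  exact Finset.sum_congr rfl fun k _ => by rw [Complex.conj_mul']

variable [DecidableEq ι]

variable {Φ M : Matrix ι ι ℂ} {d : ι → ℝ}

/-- det M divides ∏ d_i ≠ 0, so nothing need be known about Φ beforehand. -/
lemma isUnit_det_of_factor (hd : ∀ i, 0 < d i)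
    (h : M * Φ * M.conjTranspose = Matrix.diagonal fun i => (d i : ℂ)) : IsUnit M.det := by
  have := congrArg Matrix.det h
  rw [Matrix.det_mul, Matrix.det_mul, Matrix.det_diagonal] at this
  have h0 : ∏ i, (d i : ℂ) ≠ 0 :=
    Finset.prod_ne_zero_iff.2 fun i _ => Complex.ofReal_ne_zero.2 (hd i).ne'
  rw [← this] at h0
  exact (left_ne_zero_of_mul (left_ne_zero_of_mul h0)).isUnit

lemma exists_vecMul_eq (hM : IsUnit M.det) (U : ι → ℂ) : ∃ V, Matrix.vecMul V M = U :=
  ⟨Matrix.vecMul U M⁻¹, by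
    rw [Matrix.vecMul_vecMul, Matrix.nonsing_inv_mul _ hM, Matrix.vecMul_one]⟩

/-- In the coordinates U = V M the form is diagonal; positivity and definiteness of Φ are read off
from this. -/
lemma sesq_vecMul_of_factor
    (h : M * Φ * M.conjTranspose = Matrix.diagonal fun i => (d i : ℂ)) (V : ι → ℂ) :
    sesq Φ (Matrix.vecMul V M) = ((∑ i, d i * ‖V i‖ ^ 2 : ℝ) : ℂ) := by
  rw [sesq_vecMul, h, sesq_diagonal]
  push_cast
  exact Finset.sum_congr rfl fun i _ => by rw [Complex.mul_conj']

lemma re_sesq_nonneg_of_factor (hd : ∀ i, 0 < d i)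
    (h : M * Φ * M.conjTranspose = Matrix.diagonal fun i => (d i : ℂ)) (U : ι → ℂ) :
    0 ≤ (sesq Φ U).re := by
  obtain ⟨V, rfl⟩ := exists_vecMul_eq (isUnit_det_of_factor hd h) U
  rw [sesq_vecMul_of_factor h, Complex.ofReal_re]
  exact Finset.sum_nonneg fun i _ => mul_nonneg (hd i).le (by positivity)

lemma eq_zero_of_re_sesq_nonpos (hd : ∀ i, 0 < d i)
    (h : M * Φ * M.conjTranspose = Matrix.diagonal fun i => (d i : ℂ)) {U : ι → ℂ}
    (hU : (sesq Φ U).re ≤ 0) : U = 0 := by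
  obtain ⟨V, rfl⟩ := exists_vecMul_eq (isUnit_det_of_factor hd h) U
  rw [sesq_vecMul_of_factor h, Complex.ofReal_re] at hU
  have hnn : ∀ i ∈ Finset.univ, 0 ≤ d i * ‖V i‖ ^ 2 :=
    fun i _ => mul_nonneg (hd i).le (by positivity)
  have h0 := (Finset.sum_eq_zero_iff_of_nonneg hnn).1 (le_antisymm hU (Finset.sum_nonneg hnn))
  have : V = 0 := by
    ext i
    have := h0 i (Finset.mem_univ i)
    simpa [(hd i).ne'] using this
  rw [this, Matrix.zero_vecMul]

/-- If the sum of nonnegative terms vanished, column j of M would be zero, against invertibility. -/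
lemma factorDiag_pos (hd : ∀ i, 0 < d i) (hM : IsUnit M.det) (j : ι) : 0 < factorDiag M d j := by
  refine lt_of_le_of_ne (Finset.sum_nonneg fun k _ => by have := hd k; positivity) fun h0 => ?_
  have h1 := (Finset.sum_eq_zero_iff_of_nonneg fun k _ => by
    have := hd k; positivity).1 h0.symm
  have hcol : ∀ k, M k j = 0 := fun k => by
    have := h1 k (Finset.mem_univ k)
    simpa [(hd k).ne'] using this
  exact hM.ne_zero (Matrix.det_eq_zero_of_column_eq_zero j hcol)

lemma factorRow_self (hd : ∀ i, 0 < d i) (hM : IsUnit M.det) (j : ι) : factorRow M d j j = 1 := by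
  rw [factorRow, sum_conj_mul_div_self]
  exact div_self (Complex.ofReal_ne_zero.2 (factorDiag_pos hd hM j).ne')

/-- Completing the square: the minimum of `U Φ U^*` subject to `U_j = 1`. -/
lemma sesq_eq_add_of_factor (hd : ∀ i, 0 < d i)
    (h : M * Φ * M.conjTranspose = Matrix.diagonal fun i => (d i : ℂ)) (j : ι) {U : ι → ℂ}
    (hU : U j = 1) :
    sesq Φ U = sesq Φ (U - factorRow M d j) + ((factorDiag M d j)⁻¹ : ℝ) := by
  have hM := isUnit_det_of_factor hd h
  have hpos := factorDiag_pos hd hM j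
  obtain ⟨V, rfl⟩ := exists_vecMul_eq hM U
  set θ := factorDiag M d j with hθ
  have hθ0 : (θ : ℂ) ≠ 0 := Complex.ofReal_ne_zero.2 hpos.ne'
  -- The coordinates of `factorRow` with respect to M. With U = V M the constraint is ∑ V_k M_kj =
  -- 1, and d_k conj(y_k) = M_kj/θ, so the d-weighted pairings of V with y, y with V and y with
  -- itself all equal 1/θ. Thus |V - y|² = |V|² - 1/θ in the weighted norm.
  set y : ι → ℂ := fun k => (starRingEnd ℂ) (M k j) / d k / θ with hy
  have hrow : factorRow M d j = Matrix.vecMul y M := by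
    ext i
    simp only [factorRow, Matrix.vecMul, dotProduct, hy, Finset.sum_div]
    exact Finset.sum_congr rfl fun k _ => by ring
  have hV : ∑ k, V k * M k j = 1 := hU
  have hdy : ∀ k, (d k : ℂ) * (starRingEnd ℂ) (y k) = M k j / θ := fun k => by
    have : (d k : ℂ) ≠ 0 := Complex.ofReal_ne_zero.2 (hd k).ne'
    simp only [hy, map_div₀, Complex.conj_conj, Complex.conj_ofReal]
    field_simp
  have hdy' : ∀ k, (d k : ℂ) * y k = (starRingEnd ℂ) (M k j) / θ := fun k => by
    have : (d k : ℂ) ≠ 0 := Complex.ofReal_ne_zero.2 (hd k).ne'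
    simp only [hy]
    field_simp
  rw [hrow, ← Matrix.sub_vecMul, sesq_vecMul, sesq_vecMul, h, sesq_diagonal, sesq_diagonal]
  have e1 : ∑ k, V k * ((d k : ℂ) * (starRingEnd ℂ) (y k)) = 1 / θ := by
    simp only [hdy, mul_div_assoc', ← Finset.sum_div, hV]
  have e2 : ∑ k, ((d k : ℂ) * y k) * (starRingEnd ℂ) (V k) = 1 / θ := by
    have := congrArg (starRingEnd ℂ) hV
    simp only [map_sum, map_mul, map_one] at this
    simp only [hdy', div_mul_eq_mul_div, ← Finset.sum_div]
    rw [← this]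
    congr 1
    exact Finset.sum_congr rfl fun k _ => mul_comm _ _
  have e3 : ∑ k, y k * ((d k : ℂ) * (starRingEnd ℂ) (y k)) = 1 / θ := by
    simp only [hdy]
    have hk : ∀ k, y k * (M k j / θ) = (starRingEnd ℂ) (M k j) * M k j / d k / θ / θ :=
      fun k => by simp only [hy]; ring
    simp only [hk, ← Finset.sum_div, sum_conj_mul_div_self]
    rw [← hθ, div_self hθ0]
  have : ∀ k, (d k : ℂ) * ((V - y) k * (starRingEnd ℂ) ((V - y) k)) =
      (d k : ℂ) * (V k * (starRingEnd ℂ) (V k)) - V k * ((d k : ℂ) * (starRingEnd ℂ) (y k))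
        - ((d k : ℂ) * y k) * (starRingEnd ℂ) (V k)
        + y k * ((d k : ℂ) * (starRingEnd ℂ) (y k)) := fun k => by
    simp only [Pi.sub_apply, map_sub]; ring
  simp only [this, Finset.sum_add_distrib, Finset.sum_sub_distrib, e1, e2, e3]
  push_cast
  ring


end Forms

/-! ### Dropping one index -/

section Erase

variable {ι : Type*} [Fintype ι] [DecidableEq ι]

lemma sesq_eq_sesq_submatrix (Φ : Matrix ι ι ℂ) {j : ι} {U : ι → ℂ} (hU : U j = 0) :
    sesq Φ U = sesq (Φ.submatrix Subtype.val Subtype.val) fun i : {i : ι // i ≠ j} => U i := by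
  simp only [sesq]
  rw [Fintype.sum_eq_add_sum_subtype_ne _ j, Finset.sum_eq_zero fun l _ => by rw [hU]; ring,
    zero_add]
  refine Finset.sum_congr rfl fun i _ => ?_
  rw [Fintype.sum_eq_add_sum_subtype_ne _ j, hU, map_zero, mul_zero, zero_add]
  rfl

end Erase

section Extend

variable {ι : Type*} [DecidableEq ι]

/-- Extend a vector indexed by `i ≠ j` by a given value at `j`. -/
def extendAt {R : Type*} (j : ι) (c : R) (V : {i : ι // i ≠ j} → R) (i : ι) : R :=
  if h : i = j then c else V ⟨i, h⟩

@[simp] lemma extendAt_self {R : Type*} (j : ι) (c : R) (V : {i : ι // i ≠ j} → R) :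
    extendAt j c V j = c := dif_pos rfl

@[simp] lemma extendAt_val {R : Type*} (j : ι) (c : R) (V : {i : ι // i ≠ j} → R)
    (i : {i : ι // i ≠ j}) : extendAt j c V i = V i := dif_neg i.2

end Extend

/-! ### Spectral densities of square-integrable sequences -/

section Spectral

variable {Ω : Type*} [MeasurableSpace Ω] {μ : Measure Ω} {ι : Type*} {x : ι → ℤ → Lp ℝ 2 μ}

lemma inner_eq_integral_mul (u v : Lp ℝ 2 μ) : inner ℝ u v = ∫ w, u w * v w ∂μ := by
  rw [L2.inner_def]
  exact integral_congr_ae (Eventually.of_forall fun w => by simp [mul_comm])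

lemma norm_sub_sq_eq_integral (u v : Lp ℝ 2 μ) : ‖u - v‖ ^ 2 = ∫ w, (u w - v w) ^ 2 ∂μ := by
  rw [← real_inner_self_eq_norm_sq, inner_eq_integral_mul]
  refine integral_congr_ae ?_
  filter_upwards [Lp.coeFn_sub u v] with w hw
  rw [hw, Pi.sub_apply, sq]

lemma costationary_of_wss (h : JointlyWSS μ x) (hs : SummableCorr μ x) (i l : ι) :
    Costationary (x i) (x l) := by
  refine ⟨fun s t r => ?_, ?_⟩
  · rw [inner_eq_integral_mul, inner_eq_integral_mul, h.2]
  · simp only [inner_eq_integral_mul]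
    exact hs i l

lemma psd_eq_crossSpectrum (x : ι → ℤ → Lp ℝ 2 μ) (ω : ℝ) (i l : ι) :
    psd μ x ω i l = crossSpectrum (x i) (x l) ω := by
  simp only [psd, Matrix.of_apply, crossSpectrum, inner_eq_integral_mul, corr]

lemma continuous_psd (hx : ∀ i l, Costationary (x i) (x l)) (i l : ι) :
    Continuous fun ω => psd μ x ω i l := by
  simp only [psd_eq_crossSpectrum]
  exact (hx i l).continuous_crossSpectrum

lemma psd_self_eq_ofReal (hx : ∀ i l, Costationary (x i) (x l)) (i : ι) (ω : ℝ) :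
    psd μ x ω i i = ((psd μ x ω i i).re : ℂ) := by
  rw [eq_comm, ← Complex.conj_eq_iff_re, psd_eq_crossSpectrum, ← (hx i i).crossSpectrum_symm]

lemma psd_periodic (x : ι → ℤ → Lp ℝ 2 μ) (i l : ι) :
    Function.Periodic (fun ω => psd μ x ω i l) (2 * π) := by
  intro ω
  simp only [psd, Matrix.of_apply]
  refine tsum_congr fun k => ?_
  congr 1
  rw [Complex.exp_eq_exp_iff_exists_int]
  exact ⟨-k, by push_cast; ring⟩

/-- The correlations are real. This symmetry passes to the optimal response and is what allows
approximation by real taps. -/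
lemma psd_neg (x : ι → ℤ → Lp ℝ 2 μ) (i l : ι) (ω : ℝ) :
    psd μ x (-ω) i l = (starRingEnd ℂ) (psd μ x ω i l) := by
  simp only [psd, Matrix.of_apply, Complex.conj_tsum]
  refine tsum_congr fun k => ?_
  rw [map_mul, Complex.conj_ofReal, conj_exp_neg_I_mul_mul_int]
  congr 3
  push_cast
  ring

/-! ### Finite impulse response filters -/

/-- Translation of sequences by `L`. -/
def translate (E : Type*) [AddCommGroup E] [Module ℝ E] (L : ℤ) : Module.End ℝ (ℤ → E) where
  toFun f k := f (k - L)
  map_add' _ _ := rfl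
  map_smul' _ _ := rfl

/-- The operator on sequences with finitely many taps `c`. -/
def firOp (E : Type*) [AddCommGroup E] [Module ℝ E] (c : ℤ →₀ ℝ) : Module.End ℝ (ℤ → E) :=
  ∑ L ∈ c.support, c L • translate E L

lemma hasSymbolAt_firOp {E : Type*} [NormedAddCommGroup E] [InnerProductSpace ℝ E]
    {κ : Type*} (h : κ → ℤ →₀ ℝ) (i : κ) (ω : ℝ) :
    HasSymbolAt (firOp E (h i)) ω (firResponse h i ω) :=
  HasSymbolAt.sum fun L _ => HasSymbolAt.smul (T := translate E L)
    (fun u v huv => ⟨huv.translate_left L, crossSpectrum_translate_left u v L ω⟩) _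

variable [Fintype ι]

lemma firOutput_eq_sum_firOp (x : ι → ℤ → Lp ℝ 2 μ) (h : ι → ℤ →₀ ℝ) :
    firOutput μ x h = ∑ i, firOp _ (h i) (x i) := by
  ext1 k
  rw [Finset.sum_apply]
  simp only [firOutput, firOp, LinearMap.sum_apply, Finset.sum_apply]
  rfl

lemma costationary_firOutput (hx : ∀ i l, Costationary (x i) (x l)) (h : ι → ℤ →₀ ℝ) :
    Costationary (firOutput μ x h) (firOutput μ x h) := by
  rw [firOutput_eq_sum_firOp]
  exact (crossSpectrum_sum_sum (s := Finset.univ) (s' := Finset.univ) hx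
    (fun i _ => hasSymbolAt_firOp h i 0) fun i _ => hasSymbolAt_firOp h i 0).1

lemma crossSpectrum_firOutput (hx : ∀ i l, Costationary (x i) (x l)) (h : ι → ℤ →₀ ℝ) (ω : ℝ) :
    crossSpectrum (firOutput μ x h) (firOutput μ x h) ω =
      sesq (psd μ x ω) fun i => firResponse h i ω := by
  rw [firOutput_eq_sum_firOp, (crossSpectrum_sum_sum (s := Finset.univ) (s' := Finset.univ)
    hx (fun i _ => hasSymbolAt_firOp h i ω)
    fun i _ => hasSymbolAt_firOp h i ω).2]
  simp only [sesq, psd_eq_crossSpectrum]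

/-- The mean square of the output of a finite impulse response filter. -/
lemma integral_sesq_firResponse (hx : ∀ i l, Costationary (x i) (x l)) (h : ι → ℤ →₀ ℝ) (k : ℤ) :
    ∫ ω in Set.Ioc (-π) π, (sesq (psd μ x ω) fun i => firResponse h i ω).re =
      2 * π * ‖firOutput μ x h k‖ ^ 2 := by
  have hc := costationary_firOutput hx h
  have hI : IntegrableOn (crossSpectrum (firOutput μ x h) (firOutput μ x h)) (Set.Ioc (-π) π) :=
    hc.continuous_crossSpectrum.integrableOn_Icc.mono_set Set.Ioc_subset_Icc_self
  have h1 : ∫ ω in Set.Ioc (-π) π, (crossSpectrum (firOutput μ x h) (firOutput μ x h) ω).re =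
      (∫ ω in Set.Ioc (-π) π, crossSpectrum (firOutput μ x h) (firOutput μ x h) ω).re :=
    integral_re hI
  simp only [← crossSpectrum_firOutput hx]
  rw [h1, hc.integral_crossSpectrum, Complex.ofReal_re, ← real_inner_self_eq_norm_sq]
  have := hc.shift 0 0 k
  rw [zero_add] at this
  rw [this]

lemma continuous_firResponse {κ : Type*} (h : κ → ℤ →₀ ℝ) (i : κ) :
    Continuous (firResponse h i) :=
  continuous_finsetSum _ fun L _ =>
    continuous_const.mul (continuous_exp_neg_I_mul_mul_int L)

end Spectral

/-! ### The network in the frequency domain -/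

namespace Network

variable {n : ℕ} (D : Network n)

lemma S_one (i : Fin n) : D.S i 1 = ∑ j ∈ Finset.univ.erase i, (D.b i j : ℂ) := by
  rw [S, Finset.sum_eq_zero, zero_add]
  intro m hm
  rw [inv_one, sub_self, mul_zero, zero_div, zero_pow (by have := Finset.mem_Icc.1 hm; omega),
    mul_zero]

/-- Evaluate at z = 1: the bilinear factor vanishes there and S_i(1) is a sum of nonnegative weights
including b_ij, so b_ij ≠ 0 forces S_i(1) ≠ 0. Hence division by zero cannot make the transfer
function vanish identically. -/
lemma H_ne_zero_iff (i j : Fin n) : D.H i j ≠ 0 ↔ i ≠ j ∧ D.b i j ≠ 0 := by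
  constructor
  · intro h
    refine ⟨fun hij => h ?_, fun hb => h ?_⟩
    · ext z; simp [H, hij]
    · ext z; simp [H, hb]
  · rintro ⟨hij, hb⟩ h
    have h1 := congrFun h 1
    rw [H, if_neg hij, Pi.zero_apply, div_eq_zero_iff] at h1
    rcases h1 with h1 | h1
    · exact hb (by exact_mod_cast h1)
    · rw [S_one] at h1
      have h2 : ∑ k ∈ Finset.univ.erase i, D.b i k = 0 := by exact_mod_cast h1
      exact hb ((Finset.sum_eq_zero_iff_of_nonneg fun k _ => D.b_nonneg i k).1 h2 j
        (Finset.mem_erase.2 ⟨hij.symm, Finset.mem_univ j⟩))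

lemma mem_neighbors (i j : Fin n) :
    i ∈ D.neighbors j ↔ i ≠ j ∧ (D.b i j ≠ 0 ∨ D.b j i ≠ 0) := by
  simp only [neighbors, topology, Finset.mem_filter, Finset.mem_univ, true_and,
    SimpleGraph.fromRel_adj, H_ne_zero_iff]
  constructor
  · rintro ⟨h, h' | h'⟩
    · exact ⟨h.symm, Or.inr h'.2⟩
    · exact ⟨h.symm, Or.inl h'.2⟩
  · rintro ⟨h, h' | h'⟩
    · exact ⟨h.symm, Or.inr ⟨h, h'⟩⟩
    · exact ⟨h.symm, Or.inl ⟨h.symm, h'⟩⟩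

lemma parents_eq_neighbors {j : Fin n} (h : D.children j ⊆ D.parents j) :
    D.parents j = D.neighbors j := by
  ext i
  have hi := @h i
  simp only [children, parents, Finset.mem_filter, Finset.mem_univ, true_and,
    H_ne_zero_iff] at hi ⊢
  rw [mem_neighbors]
  constructor
  · exact fun h' => ⟨h'.1.symm, Or.inr h'.2⟩
  · rintro ⟨h1, h2 | h2⟩
    · exact hi ⟨h1, h2⟩
    · exact ⟨h1.symm, h2⟩

/-- The matrix `diag(S_i) - (b_{ij})` at `z`. -/
def dynMatrix (z : ℂ) : Matrix (Fin n) (Fin n) ℂ :=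
  Matrix.of fun i k => if k = i then D.S i z else -(D.b i k : ℂ)

/-- The difference operators of the dynamics. -/
def dynOp (E : Type*) [AddCommGroup E] [Module ℝ E] (i k : Fin n) : Module.End ℝ (ℤ → E) :=
  if k = i then
    ∑ m ∈ Finset.Icc 1 D.order, (D.a m i * (2 / D.dt) ^ m) •
        ((1 - backshift E) ^ m * (1 + backshift E) ^ (D.order - m))
      + (∑ j ∈ Finset.univ.erase i, D.b i j) • (1 + backshift E) ^ D.order
  else (-D.b i k) • (1 + backshift E) ^ D.order

lemma Satisfies.sum_dynOp {D : Network n} {E : Type*} [AddCommGroup E] [Module ℝ E]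
    {x p : Fin n → ℤ → E} (h : D.Satisfies x p) (i : Fin n) :
    ∑ k, D.dynOp E i k (x k) = ((1 + backshift E) ^ D.order) (p i) := by
  have hi := h i
  rw [map_add, ← sub_eq_iff_eq_add'] at hi
  rw [← hi, ← Finset.add_sum_erase _ _ (Finset.mem_univ i), sub_eq_add_neg]
  congr 1
  · simp [dynOp, LinearMap.sum_apply]
  · rw [map_sum, ← Finset.sum_neg_distrib]
    refine Finset.sum_congr rfl fun k hk => ?_
    rw [dynOp, if_neg (Finset.ne_of_mem_erase hk), LinearMap.smul_apply, map_smul, neg_smul]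

lemma hasSymbolAt_dynOp {E : Type*} [NormedAddCommGroup E] [InnerProductSpace ℝ E] {ω : ℝ}
    (hω : 1 + Complex.exp (-(Complex.I * ω)) ≠ 0) (i k : Fin n) :
    HasSymbolAt (D.dynOp E i k) ω
      ((1 + Complex.exp (-(Complex.I * ω))) ^ D.order *
        D.dynMatrix (Complex.exp (Complex.I * ω)) i k) := by
  have hB := HasSymbolAt.backshift (E := E) ω
  set w := Complex.exp (-(Complex.I * ω)) with hw
  have hz : (Complex.exp (Complex.I * ω))⁻¹ = w := by rw [hw, Complex.exp_neg]
  have hc := (HasSymbolAt.one.add hB).pow D.order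
  have hdt : (D.dt : ℂ) ≠ 0 := Complex.ofReal_ne_zero.2 D.dt_pos.ne'
  rw [dynOp, dynMatrix, Matrix.of_apply]
  split_ifs with hk
  · convert (HasSymbolAt.sum fun m _ => (((HasSymbolAt.one.sub hB).pow m).mul
      ((HasSymbolAt.one.add hB).pow (D.order - m))).smul (D.a m i * (2 / D.dt) ^ m)).add
      (hc.smul (∑ j ∈ Finset.univ.erase i, D.b i j)) using 1
    rw [S, mul_add, Finset.mul_sum]
    congr 1
    · refine Finset.sum_congr rfl fun m hm => ?_
      -- Of the `order` factors 1 + w, exactly m cancel the denominator of the m-th bilinear power;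
      -- here 1 + w ≠ 0 is needed.
      have hm' : D.order = m + (D.order - m) := by have := Finset.mem_Icc.1 hm; omega
      rw [hz]
      nth_rewrite 1 [hm']
      rw [pow_add]
      have hq : 2 * (1 - w) / ((D.dt : ℂ) * (1 + w)) = 2 / D.dt * (1 - w) * (1 + w)⁻¹ := by
        field_simp
      have hi : (1 + w) ^ m * ((1 + w)⁻¹) ^ m = 1 := by
        rw [← mul_pow, mul_inv_cancel₀ hω, one_pow]
      rw [hq, mul_pow, mul_pow _ (1 - w)]
      push_cast
      linear_combination (1 + w) ^ (D.order - m) * D.a m i * (2 / D.dt) ^ m * (1 - w) ^ m * hi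
    · push_cast; ring
  · convert hc.smul (-D.b i k) using 1
    push_cast; ring

lemma one_add_exp_ne_zero_ae :
    ∀ᵐ ω : ℝ ∂(volume.restrict (Set.Ioc (-π) π)), 1 + Complex.exp (-(Complex.I * (ω : ℂ))) ≠ 0 := by
  have h1 : ∀ᵐ ω ∂(volume.restrict (Set.Ioc (-π) π)), ω ≠ π :=
    ae_restrict_of_ae (Measure.ae_ne (volume : Measure ℝ) π)
  filter_upwards [h1, ae_restrict_mem measurableSet_Ioc] with ω hω hmem h0
  have h2 : Complex.exp (-(Complex.I * (ω : ℂ))) = Complex.exp (-(Complex.I * (π : ℂ))) := by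
    rw [Complex.exp_neg (Complex.I * π), mul_comm Complex.I (π : ℂ), Complex.exp_pi_mul_I]
    rw [eq_neg_of_add_eq_zero_right h0]; norm_num
  rw [Complex.exp_eq_exp_iff_exists_int] at h2
  obtain ⟨N, hN⟩ := h2
  have h3 : (ω : ℂ) = π - 2 * N * π := by
    have : Complex.I * (ω : ℂ) = Complex.I * (π - 2 * N * π) := by linear_combination -hN
    exact mul_left_cancel₀ Complex.I_ne_zero this
  have h4 : ω = π - 2 * N * π := by exact_mod_cast h3
  -- N = 0 is the excluded point π; N ≤ -1 gives ω ≥ 3π and N ≥ 1 gives ω ≤ -π, both outside the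
  -- half-open period.
  have hN0 : N ≠ 0 := by
    rintro rfl
    exact hω (by simpa using h4)
  rcases lt_or_gt_of_ne hN0 with hlt | hgt
  · have : (N : ℝ) ≤ -1 := by exact_mod_cast Int.le_sub_one_of_lt hlt
    have := hmem.2
    nlinarith [pi_pos]
  · have : (1 : ℝ) ≤ N := by exact_mod_cast hgt
    have := hmem.1
    nlinarith [pi_pos]

/-! ### Spectral factorization of the network and the entries of the inverse spectrum -/

section Factor

variable {Ω : Type*} [MeasurableSpace Ω] {μ : Measure Ω} {x p : Fin n → ℤ → Lp ℝ 2 μ}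

/-- The spectral form of the dynamics. -/
lemma Satisfies.factor {D : Network n} (h : D.Satisfies x p)
    (hx : ∀ i l, Costationary (x i) (x l)) (hp : ∀ i l, Costationary (p i) (p l))
    (huncorr : ∀ i l, i ≠ l → ∀ s t, ∫ w, p i s w * p l t w ∂μ = 0) {ω : ℝ}
    (hω : 1 + Complex.exp (-(Complex.I * ω)) ≠ 0) :
    D.dynMatrix (Complex.exp (Complex.I * ω)) * psd μ x ω *
        (D.dynMatrix (Complex.exp (Complex.I * ω))).conjTranspose =
      Matrix.diagonal fun i => ((psd μ p ω i i).re : ℂ) := by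
  set M := D.dynMatrix (Complex.exp (Complex.I * ω))
  set c := (1 + Complex.exp (-(Complex.I * ω))) ^ D.order with hc
  have hc0 : c ≠ 0 := pow_ne_zero _ hω
  have hcc : (starRingEnd ℂ) c ≠ 0 := (map_ne_zero _).2 hc0
  have hC := (HasSymbolAt.one.add (HasSymbolAt.backshift (E := Lp ℝ 2 μ) ω)).pow D.order
  ext i l
  have e1 := (crossSpectrum_sum_sum (s := Finset.univ) (s' := Finset.univ)
    hx (fun k _ => D.hasSymbolAt_dynOp (E := Lp ℝ 2 μ) hω i k)
    fun k _ => D.hasSymbolAt_dynOp (E := Lp ℝ 2 μ) hω l k).2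
  simp only [h.sum_dynOp] at e1
  -- The cross spectrum of (1 + B)^order p_i and (1 + B)^order p_l is computed a second time, now
  -- from the symbol c; comparison with `e1` leaves the common factor c c* to cancel.
  have e2 := hC _ _ (hC _ _ (hp l i)).1.symm
  rw [e2.2, (hC _ _ (hp l i)).1.crossSpectrum_symm, (hC _ _ (hp l i)).2, map_mul,
    ← (hp l i).crossSpectrum_symm, ← psd_eq_crossSpectrum] at e1
  have e3 : c * (starRingEnd ℂ) c * (M * psd μ x ω * M.conjTranspose) i l =
      c * (starRingEnd ℂ) c * psd μ p ω i l := by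
    calc _ = _ := ?_
      _ = _ := e1.symm
      _ = _ := by ring
    rw [Matrix.mul_apply, Finset.mul_sum, Finset.sum_comm]
    refine Finset.sum_congr rfl fun m _ => ?_
    rw [Matrix.mul_apply, Finset.sum_mul, Finset.mul_sum]
    refine Finset.sum_congr rfl fun k _ => ?_
    rw [Matrix.conjTranspose_apply, ← psd_eq_crossSpectrum, map_mul, starRingEnd_apply (M l m)]
    ring
  have e4 := mul_left_cancel₀ (mul_ne_zero hc0 hcc) e3
  rw [e4]
  by_cases hil : i = l
  · subst hil
    rw [Matrix.diagonal_apply_eq, ← psd_self_eq_ofReal hp]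
  · rw [Matrix.diagonal_apply_ne _ hil]
    simp [psd, corr, huncorr i l hil]

/-- Column j of M is S_j at j and -b_kj elsewhere, and b_kj = 0 unless k is a neighbor of j. -/
lemma factorDiag_dynMatrix (hp : ∀ i l, Costationary (p i) (p l)) (j : Fin n) (ω : ℝ) :
    (factorDiag (D.dynMatrix (Complex.exp (Complex.I * ω))) (fun i => (psd μ p ω i i).re) j : ℂ) =
      D.denom μ p (D.neighbors j) j ω := by
  rw [factorDiag, denom, ← Finset.add_sum_erase _ _ (Finset.mem_univ j), Complex.ofReal_add,
    Complex.ofReal_sum]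
  congr 1
  · rw [dynMatrix, Matrix.of_apply, if_pos rfl, Complex.ofReal_div, ← psd_self_eq_ofReal hp,
      div_eq_mul_inv]
  · rw [eq_comm]
    have hsub : D.neighbors j ⊆ Finset.univ.erase j := fun i hi =>
      Finset.mem_erase.2 ⟨((D.mem_neighbors i j).1 hi).1, Finset.mem_univ i⟩
    rw [Finset.sum_subset hsub]
    · refine Finset.sum_congr rfl fun k hk => ?_
      rw [dynMatrix, Matrix.of_apply, if_neg (Finset.ne_of_mem_erase hk).symm,
        Complex.ofReal_div, ← psd_self_eq_ofReal hp, div_eq_mul_inv, norm_neg, Complex.norm_real,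
        norm_eq_abs, sq_abs, Complex.ofReal_pow]
    · intro k hk hk'
      have : D.b k j = 0 := by
        by_contra hb
        exact hk' ((D.mem_neighbors k j).2 ⟨Finset.ne_of_mem_erase hk, Or.inl hb⟩)
      rw [this]; simp

/-- In ∑_k conj(M_kj) M_ki / Φ_{p_k} the index k = i gives minus the child numerator and k = j minus
the parent numerator. For other k the two signs cancel, giving b_kj b_ki, which vanishes unless k is
a common neighbor. -/
lemma factorRow_dynMatrix (hp : ∀ i l, Costationary (p i) (p l)) {i j : Fin n} (hij : i ≠ j)
    (ω : ℝ) :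
    factorRow (D.dynMatrix (Complex.exp (Complex.I * ω))) (fun i => (psd μ p ω i i).re) j i =
      -(D.childTerm μ p j i ω + D.parentTerm μ p j i ω + D.spouseTerm μ p j i ω) := by
  rw [factorRow, D.factorDiag_dynMatrix hp, childTerm, parentTerm, spouseTerm]
  rw [← add_div, ← neg_div, ← add_div, ← neg_div]
  congr 1
  rw [← Finset.add_sum_erase _ _ (Finset.mem_univ i),
    ← Finset.add_sum_erase _ _ (Finset.mem_erase.2 ⟨hij.symm, Finset.mem_univ j⟩)]
  have hsub : D.neighbors i ∩ D.neighbors j ⊆ (Finset.univ.erase i).erase j := fun k hk => by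
    rw [Finset.mem_inter, mem_neighbors, mem_neighbors] at hk
    simp [hk.1.1, hk.2.1]
  rw [Finset.sum_subset hsub]
  · have hs : ∑ k ∈ (Finset.univ.erase i).erase j,
        (starRingEnd ℂ) (D.dynMatrix (Complex.exp (Complex.I * ω)) k j) *
          D.dynMatrix (Complex.exp (Complex.I * ω)) k i / ((psd μ p ω k k).re : ℂ) =
        ∑ k ∈ (Finset.univ.erase i).erase j,
          (D.b k j : ℂ) * (D.b k i : ℂ) * (psd μ p ω k k)⁻¹ := by
      refine Finset.sum_congr rfl fun k hk => ?_
      have hkj := Finset.ne_of_mem_erase hk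
      have hki := Finset.ne_of_mem_erase (Finset.mem_of_mem_erase hk)
      rw [← psd_self_eq_ofReal hp, dynMatrix, Matrix.of_apply, Matrix.of_apply, if_neg hkj.symm,
        if_neg hki.symm, map_neg, Complex.conj_ofReal, neg_mul_neg, div_eq_mul_inv]
    rw [hs, ← psd_self_eq_ofReal hp, ← psd_self_eq_ofReal hp]
    simp only [dynMatrix, Matrix.of_apply, if_true, if_neg hij, if_neg hij.symm, map_neg,
      Complex.conj_ofReal]
    ring
  · intro k hk hk'
    have hkj := Finset.ne_of_mem_erase hk
    have hki := Finset.ne_of_mem_erase (Finset.mem_of_mem_erase hk)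
    have : D.b k j = 0 ∨ D.b k i = 0 := by
      by_contra! hb
      exact hk' (Finset.mem_inter.2 ⟨(D.mem_neighbors k i).2 ⟨hki, Or.inl hb.2⟩,
        (D.mem_neighbors k j).2 ⟨hkj, Or.inl hb.1⟩⟩)
    rcases this with h | h <;> rw [h] <;> simp

end Factor

end Network

/-! ### Approximation of frequency responses by finite impulse responses -/

section Approximation

/-- The Fourier coefficients of a conjugate symmetric function are real. -/
lemma conj_fourierCoeff {T : ℝ} [Fact (0 < T)] {f : AddCircle T → ℂ}
    (hf : ∀ t, f (-t) = (starRingEnd ℂ) (f t)) (n : ℤ) :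
    (starRingEnd ℂ) (fourierCoeff f n) = fourierCoeff f n := by
  rw [fourierCoeff, ← integral_conj, ← integral_neg_eq_self]
  refine integral_congr_ae (Eventually.of_forall fun t => ?_)
  simp only [smul_eq_mul, map_mul, hf, Complex.conj_conj]
  congr 1
  rw [← fourier_neg, fourier_apply, fourier_apply]
  simp

/-- Real taps whose frequency response is the Fourier partial sum with coefficients `a`. -/
def tapsOfCoeffs (a : ℤ → ℝ) (s : Finset ℤ) : ℤ →₀ ℝ := ∑ n ∈ s, Finsupp.single (-n) (a n)

/-- A tap at lag L contributes exp(-iωL), so the n-th Fourier mode sits at lag -n. -/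
lemma sum_tapsOfCoeffs (a : ℤ → ℝ) (s : Finset ℤ) (ω : ℝ) :
    ((tapsOfCoeffs a s).sum fun L c => (c : ℂ) * Complex.exp (-(Complex.I * (ω : ℂ) * (L : ℂ)))) =
      ∑ n ∈ s, (a n : ℂ) * Complex.exp (Complex.I * ω * n) := by
  rw [tapsOfCoeffs, ← Finsupp.sum_finsetSum_index (fun L => by simp)
    fun L b₁ b₂ => by push_cast; ring]
  refine Finset.sum_congr rfl fun n _ => ?_
  rw [Finsupp.sum_single_index (by simp)]
  congr 2
  push_cast
  ring

/-- Mean square approximation of a bounded periodic conjugate symmetric function. -/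
lemma exists_taps_tendsto {f : ℝ → ℂ} (hm : Measurable f) (hper : Function.Periodic f (2 * π))
    (hsymm : ∀ ω, f (-ω) = (starRingEnd ℂ) (f ω)) {N : ℝ} (hN : ∀ ω, ‖f ω‖ ≤ N) :
    ∃ c : ℕ → ℤ →₀ ℝ, Tendsto (fun m => ∫⁻ ω in Set.Ioc (-π) π,
      ‖((c m).sum fun L a => (a : ℂ) * Complex.exp (-(Complex.I * (ω : ℂ) * (L : ℂ)))) - f ω‖ₑ ^ 2)
      atTop (𝓝 0) := by
  have : Fact (0 < 2 * π) := ⟨two_pi_pos⟩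
  set F : AddCircle (2 * π) → ℂ := hper.lift with hF
  have hFc : ∀ ω : ℝ, F ω = f ω := fun ω => hper.lift_coe ω
  have hFm : Measurable F := by
    have : F = fun t => f (AddCircle.measurableEquivIoc (2 * π) 0 t : ℝ) := by
      ext t
      rw [← hFc]
      exact congrArg F AddCircle.coe_equivIoc.symm
    rw [this]
    exact hm.comp (measurable_subtype_coe.comp (MeasurableEquiv.measurable _))
  have hFs : ∀ t, F (-t) = (starRingEnd ℂ) (F t) := by
    intro t
    induction t using QuotientAddGroup.induction_on with
    | H ω =>
      have := hFc (-ω)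
      rw [hsymm] at this
      exact this.trans (congrArg _ (hFc ω).symm)
  have hFN : ∀ t, ‖F t‖ ≤ N := by
    intro t
    induction t using QuotientAddGroup.induction_on with
    | H ω => exact (hFc ω).symm ▸ hN ω
  have hL : MemLp F 2 AddCircle.haarAddCircle :=
    MemLp.of_bound hFm.aestronglyMeasurable N (Eventually.of_forall hFN)
  have hco : ∀ n, fourierCoeff (hL.toLp F) n = ((fourierCoeff F n).re : ℂ) := fun n => by
    rw [fourierCoeff_congr_ae hL.coeFn_toLp]
    exact (Complex.conj_eq_iff_re.1 (conj_fourierCoeff hFs n)).symm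
  have hsum := hasSum_fourier_series_L2 (hL.toLp F)
  simp only [hco] at hsum
  obtain ⟨s, hs⟩ := exists_seq_tendsto (atTop : Filter (Finset ℤ))
  refine ⟨fun m => tapsOfCoeffs (fun n => (fourierCoeff F n).re) (s m), ?_⟩
  have ht := (hsum.comp hs)
  have ht' : Tendsto (fun m => ‖(∑ n ∈ s m, ((fourierCoeff F n).re : ℂ) •
      fourierLp (T := 2 * π) 2 n) - hL.toLp F‖ₑ ^ 2) atTop (𝓝 0) := by
    have h1 := (tendsto_iff_edist_tendsto_0.1 ht)
    simp only [edist_eq_enorm_sub, Function.comp_def] at h1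
    simpa [Function.comp_def] using ((ENNReal.continuous_pow 2).tendsto 0).comp h1
  -- The factor 2π converts normalized Haar measure on the circle to Lebesgue measure on a period.
  have hc : Tendsto (fun m => ENNReal.ofReal (2 * π) * ‖(∑ n ∈ s m,
      ((fourierCoeff F n).re : ℂ) • fourierLp (T := 2 * π) 2 n) - hL.toLp F‖ₑ ^ 2)
      atTop (𝓝 0) := by
    have h1 := ENNReal.Tendsto.const_mul (a := ENNReal.ofReal (2 * π)) ht'
      (Or.inr ENNReal.ofReal_ne_top)
    rwa [mul_zero] at h1
  refine hc.congr fun m => ?_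
  have hae : ((∑ n ∈ s m, ((fourierCoeff F n).re : ℂ) • fourierLp (T := 2 * π) 2 n) -
      hL.toLp F : Lp ℂ 2 AddCircle.haarAddCircle) =ᵐ[AddCircle.haarAddCircle]
      fun t => (∑ n ∈ s m, ((fourierCoeff F n).re : ℂ) * fourier n t) - F t := by
    have hlin : ∑ n ∈ s m, ((fourierCoeff F n).re : ℂ) • fourierLp (T := 2 * π) 2 n =
        ContinuousMap.toLp 2 AddCircle.haarAddCircle ℂ
          (∑ n ∈ s m, ((fourierCoeff F n).re : ℂ) • fourier n) := by
      simp only [map_sum, map_smul, fourierLp]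
    rw [hlin]
    filter_upwards [Lp.coeFn_sub (ContinuousMap.toLp 2 AddCircle.haarAddCircle ℂ
        (∑ n ∈ s m, ((fourierCoeff F n).re : ℂ) • fourier n)) (hL.toLp F), hL.coeFn_toLp,
      ContinuousMap.coeFn_toLp (p := 2) (𝕜 := ℂ) AddCircle.haarAddCircle
        (∑ n ∈ s m, ((fourierCoeff F n).re : ℂ) • fourier (T := 2 * π) n)] with t h1 h2 h3
    rw [h1, Pi.sub_apply, h2, h3]
    simp
  rw [Lp.enorm_def, eLpNorm_congr_ae hae]
  have h2 := eLpNorm_nnreal_pow_eq_lintegral (p := 2) (μ := AddCircle.haarAddCircle)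
    (f := fun t : AddCircle (2 * π) =>
      (∑ n ∈ s m, ((fourierCoeff F n).re : ℂ) * fourier n t) - F t) two_ne_zero
  simp only [NNReal.coe_ofNat, ENNReal.coe_ofNat, ENNReal.rpow_ofNat] at h2
  rw [h2, ← smul_eq_mul, ← lintegral_smul_measure, ← AddCircle.volume_eq_smul_haarAddCircle,
    ← AddCircle.lintegral_preimage (2 * π) (-π), show -π + 2 * π = π by ring]
  refine lintegral_congr fun ω => ?_
  rw [sum_tapsOfCoeffs, hFc]
  congr 3
  refine Finset.sum_congr rfl fun n _ => ?_
  rw [fourier_coe_apply]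
  congr 2
  have : (π : ℂ) ≠ 0 := by exact_mod_cast pi_ne_zero
  push_cast
  field_simp

variable {Ω : Type*} [MeasurableSpace Ω] {μ : Measure Ω} {κ : Type*} [Fintype κ]
  {y : κ → ℤ → Lp ℝ 2 μ}

lemma spectralDistSq_eq (y : κ → ℤ → Lp ℝ 2 μ) (V W : κ → ℝ → ℂ) :
    spectralDistSq μ y V W = ∫⁻ ω in Set.Ioc (-π) π,
      ENNReal.ofReal (sesq (psd μ y ω) fun i => V i ω - W i ω).re := rfl

lemma spectralDistSq_comm (y : κ → ℤ → Lp ℝ 2 μ) (V W : κ → ℝ → ℂ) :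
    spectralDistSq μ y V W = spectralDistSq μ y W V := by
  simp only [spectralDistSq_eq]
  refine lintegral_congr fun ω => ?_
  rw [← sesq_neg]
  congr 3
  ext i
  simp

lemma aemeasurable_re_sesq (hy : ∀ i l, Costationary (y i) (y l)) {ν : Measure ℝ}
    {U : κ → ℝ → ℂ} (hU : ∀ i, AEMeasurable (U i) ν) :
    AEMeasurable (fun ω => ENNReal.ofReal (sesq (psd μ y ω) fun i => U i ω).re) ν := by
  refine (Complex.measurable_re.comp_aemeasurable ?_).ennreal_ofReal
  simp only [sesq]
  exact Finset.aemeasurable_fun_sum _ fun i _ => Finset.aemeasurable_fun_sum _ fun l _ =>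
    ((hU i).mul (continuous_psd hy i l).measurable.aemeasurable).mul
      (Complex.continuous_conj.measurable.comp_aemeasurable (hU l))

/-- The quasi-triangle inequality in the spectral space. -/
lemma spectralDistSq_le (hy : ∀ i l, Costationary (y i) (y l))
    (hpos : ∀ᵐ ω ∂(volume.restrict (Set.Ioc (-π) π)), ∀ U, 0 ≤ (sesq (psd μ y ω) U).re)
    {U V : κ → ℝ → ℂ} (W : κ → ℝ → ℂ)
    (hU : ∀ i, AEMeasurable (U i) (volume.restrict (Set.Ioc (-π) π)))
    (hV : ∀ i, AEMeasurable (V i) (volume.restrict (Set.Ioc (-π) π))) :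
    spectralDistSq μ y U W ≤ 2 * spectralDistSq μ y U V + 2 * spectralDistSq μ y V W := by
  simp only [spectralDistSq_eq]
  rw [← lintegral_const_mul' _ _ ENNReal.ofNat_ne_top,
    ← lintegral_const_mul' _ _ ENNReal.ofNat_ne_top,
    ← lintegral_add_left' ((aemeasurable_re_sesq (U := fun i ω => U i ω - V i ω) hy
      fun i => (hU i).sub (hV i)).const_mul 2)]
  refine lintegral_mono_ae ?_
  filter_upwards [hpos] with ω hω
  have h := re_sesq_add_le hω (fun i => U i ω - V i ω) (fun i => V i ω - W i ω)
  have h2 : ∀ r : ℝ, 2 * ENNReal.ofReal r = ENNReal.ofReal (2 * r) := fun r => by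
    rw [ENNReal.ofReal_mul zero_le_two, ENNReal.ofReal_ofNat]
  rw [h2, h2, ← ENNReal.ofReal_add (mul_nonneg zero_le_two (hω _))
    (mul_nonneg zero_le_two (hω _))]
  refine ENNReal.ofReal_le_ofReal (le_trans (le_of_eq ?_) h)
  congr 2
  ext i
  simp

lemma exists_norm_psd_le (hy : ∀ i l, Costationary (y i) (y l)) :
    ∃ C : ℝ, 0 ≤ C ∧ ∀ ω i l, ‖psd μ y ω i l‖ ≤ C := by
  refine ⟨∑ i, ∑ l, ∑' k, ‖(inner ℝ (y i k) (y l 0) : ℝ)‖,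
    Finset.sum_nonneg fun i _ => Finset.sum_nonneg fun l _ => tsum_nonneg fun k => norm_nonneg _,
    fun ω i l => ?_⟩
  have hle : ‖psd μ y ω i l‖ ≤ ∑' k, ‖(inner ℝ (y i k) (y l 0) : ℝ)‖ := by
    rw [psd_eq_crossSpectrum, crossSpectrum]
    refine (norm_tsum_le_tsum_norm ?_).trans (le_of_eq ?_)
    · simpa only [norm_ofReal_mul_exp] using (hy i l).summable.norm
    · simp only [norm_ofReal_mul_exp]
  refine hle.trans ((Finset.single_le_sum (f := fun l => ∑' k, ‖(inner ℝ (y i k) (y l 0) : ℝ)‖)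
    (fun l _ => tsum_nonneg fun k => norm_nonneg _) (Finset.mem_univ l)).trans
    (Finset.single_le_sum (f := fun i => ∑ l, ∑' k, ‖(inner ℝ (y i k) (y l 0) : ℝ)‖)
    (fun i _ => Finset.sum_nonneg fun l _ => tsum_nonneg fun k => norm_nonneg _)
    (Finset.mem_univ i)))

lemma exists_fir_tendsto_of_bounded (hy : ∀ i l, Costationary (y i) (y l)) {F : κ → ℝ → ℂ}
    (hm : ∀ i, Measurable (F i)) (hper : ∀ i, Function.Periodic (F i) (2 * π))
    (hsymm : ∀ i ω, F i (-ω) = (starRingEnd ℂ) (F i ω)) {N : ℝ} (hN : ∀ i ω, ‖F i ω‖ ≤ N) :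
    ∃ g : ℕ → κ → ℤ →₀ ℝ,
      Tendsto (fun m => spectralDistSq μ y (firResponse (g m)) F) atTop (𝓝 0) := by
  obtain ⟨C, hC0, hC⟩ := exists_norm_psd_le hy
  choose c hc using fun i => exists_taps_tendsto (hm i) (hper i) (hsymm i) (hN i)
  refine ⟨fun m i => c i m, ?_⟩
  have ht : Tendsto (fun m => ENNReal.ofReal (C * Fintype.card κ) * ∑ i,
      ∫⁻ ω in Set.Ioc (-π) π, ‖firResponse (fun i => c i m) i ω - F i ω‖ₑ ^ 2) atTop (𝓝 0) := by
    have h1 := tendsto_finsetSum Finset.univ fun i _ => hc i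
    have h2 := ENNReal.Tendsto.const_mul (a := ENNReal.ofReal (C * Fintype.card κ)) h1
      (Or.inr ENNReal.ofReal_ne_top)
    rwa [Finset.sum_const_zero, mul_zero] at h2
  refine tendsto_of_tendsto_of_tendsto_of_le_of_le tendsto_const_nhds ht (fun m => zero_le)
    fun m => ?_
  simp only
  rw [spectralDistSq_eq, ← lintegral_finsetSum', ← lintegral_const_mul' _ _ ENNReal.ofReal_ne_top]
  · refine lintegral_mono fun ω => ?_
    refine (ENNReal.ofReal_le_ofReal (re_sesq_le (hC ω) _)).trans (le_of_eq ?_)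
    rw [ENNReal.ofReal_mul (by positivity), ENNReal.ofReal_sum_of_nonneg fun i _ => by positivity]
    congr 1
    refine Finset.sum_congr rfl fun i _ => ?_
    rw [ENNReal.ofReal_pow (norm_nonneg _), ofReal_norm]
  · intro i _
    exact (((continuous_firResponse _ i).measurable.sub (hm i)).enorm.pow_const 2).aemeasurable

/-- Density of finite impulse responses with real taps in the spectral space. -/
lemma exists_fir_tendsto (hy : ∀ i l, Costationary (y i) (y l))
    (hpos : ∀ᵐ ω ∂(volume.restrict (Set.Ioc (-π) π)), ∀ U, 0 ≤ (sesq (psd μ y ω) U).re)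
    {F : κ → ℝ → ℂ} (hm : ∀ i, Measurable (F i))
    (hper : ∀ i, Function.Periodic (F i) (2 * π))
    (hsymm : ∀ i ω, F i (-ω) = (starRingEnd ℂ) (F i ω))
    (hfin : spectralDistSq μ y 0 F ≠ ⊤) :
    ∃ g : ℕ → κ → ℤ →₀ ℝ,
      Tendsto (fun m => spectralDistSq μ y (firResponse (g m)) F) atTop (𝓝 0) := by
  classical
  -- F may be unbounded, so it is truncated. One set serves all components: the error integrand is
  -- then either 0 or that of the zero filter, which is integrable and dominates. Periodicity and
  -- conjugate symmetry survive because A N is invariant under both substitutions.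
  let A : ℕ → Set ℝ := fun N => {ω | ∀ i, ‖F i ω‖ ≤ N}
  have hA : ∀ N, MeasurableSet (A N) := fun N => by
    have : A N = ⋂ i, {ω | ‖F i ω‖ ≤ N} := by ext; simp [A]
    rw [this]
    exact MeasurableSet.iInter fun i => measurableSet_le (hm i).norm measurable_const
  let G : ℕ → κ → ℝ → ℂ := fun N i => (A N).indicator (F i)
  have hGm : ∀ N i, Measurable (G N i) := fun N i => (hm i).indicator (hA N)
  have hAper : ∀ N ω, ω + 2 * π ∈ A N ↔ ω ∈ A N := fun N ω => by
    simp only [A, Set.mem_ofPred_eq, (hper _) ω]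
  have hAneg : ∀ N ω, -ω ∈ A N ↔ ω ∈ A N := fun N ω => by
    simp only [A, Set.mem_ofPred_eq, hsymm, RCLike.norm_conj]
  have hG : ∀ N, ∃ g : ℕ → κ → ℤ →₀ ℝ,
      Tendsto (fun m => spectralDistSq μ y (firResponse (g m)) (G N)) atTop (𝓝 0) := by
    intro N
    refine exists_fir_tendsto_of_bounded hy (hGm N) (fun i ω => ?_) (fun i ω => ?_)
      (N := N) fun i ω => ?_
    · simp only [G, Set.indicator_apply, hAper, (hper i) ω]
    · simp only [G, Set.indicator_apply, hAneg, hsymm]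
      split_ifs <;> simp
    · simp only [G, Set.indicator_apply]
      split_ifs with h
      · exact h i
      · simp
  have hlim : Tendsto (fun N => spectralDistSq μ y (G N) F) atTop (𝓝 0) := by
    have hz : ∫⁻ _ω in Set.Ioc (-π) π, (0 : ENNReal) = 0 := lintegral_zero
    rw [← hz]
    simp only [spectralDistSq_eq]
    refine tendsto_lintegral_of_dominated_convergence'
      (fun ω => ENNReal.ofReal (sesq (psd μ y ω) fun i => (0 : κ → ℝ → ℂ) i ω - F i ω).re)
      (fun N => aemeasurable_re_sesq hy fun i => ((hGm N i).sub (hm i)).aemeasurable)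
      (fun N => Eventually.of_forall fun ω => ?_) hfin (Eventually.of_forall fun ω => ?_)
    · by_cases h : ω ∈ A N
      · simp [G, h, sesq]
      · simp [G, h]
    · refine tendsto_const_nhds.congr' ?_
      obtain ⟨N₀, hN₀⟩ := exists_nat_ge (∑ i, ‖F i ω‖)
      filter_upwards [eventually_ge_atTop N₀] with N hN
      have h : ω ∈ A N := fun i =>
        ((Finset.single_le_sum (f := fun i => ‖F i ω‖) (fun i _ => norm_nonneg _)
          (Finset.mem_univ i)).trans hN₀).trans (by exact_mod_cast hN)
      simp [G, h, sesq]
  -- Diagonal choice; at N = 0 the bound is `⊤` and harmless.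
  have hpick : ∀ N : ℕ, ∃ g : κ → ℤ →₀ ℝ,
      spectralDistSq μ y (firResponse g) (G N) ≤ (N : ENNReal)⁻¹ := by
    intro N
    obtain ⟨g, hg⟩ := hG N
    obtain ⟨m, hmm⟩ := (hg.eventually (gt_mem_nhds
      (ENNReal.inv_pos.2 (ENNReal.natCast_ne_top N)))).exists
    exact ⟨g m, hmm.le⟩
  choose g hg using hpick
  refine ⟨g, ?_⟩
  have hup : Tendsto (fun N : ℕ => 2 * (N : ENNReal)⁻¹ + 2 * spectralDistSq μ y (G N) F)
      atTop (𝓝 0) := by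
    have h1 := ENNReal.Tendsto.const_mul (a := 2) ENNReal.tendsto_inv_nat_nhds_zero
      (Or.inr ENNReal.ofNat_ne_top)
    have h2 := ENNReal.Tendsto.const_mul (a := 2) hlim (Or.inr ENNReal.ofNat_ne_top)
    simpa using h1.add h2
  refine tendsto_of_tendsto_of_tendsto_of_le_of_le tendsto_const_nhds hup (fun m => zero_le)
    fun N => (spectralDistSq_le hy hpos F
      (fun i => (continuous_firResponse _ i).measurable.aemeasurable)
      fun i => (hGm N i).aemeasurable).trans ?_
  gcongr
  exact hg N

end Approximation

/-! ### Finite impulse response outputs and the observed space -/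

section Observed

variable {Ω : Type*} [MeasurableSpace Ω] {μ : Measure Ω} {ι : Type*}

/-- The sequences other than the `j`-th one. -/
abbrev observed (x : ι → ℤ → Lp ℝ 2 μ) (j : ι) (i : {i : ι // i ≠ j}) : ℤ → Lp ℝ 2 μ := x i.1

lemma costationary_observed {x : ι → ℤ → Lp ℝ 2 μ} (hx : ∀ i l, Costationary (x i) (x l))
    (j : ι) (i l : {i : ι // i ≠ j}) : Costationary (observed x j i) (observed x j l) :=
  hx i.1 l.1

section Linear

variable [Fintype ι] (x : ι → ℤ → Lp ℝ 2 μ)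

lemma firOutput_add (h h' : ι → ℤ →₀ ℝ) (k : ℤ) :
    firOutput μ x (h + h') k = firOutput μ x h k + firOutput μ x h' k := by
  simp only [firOutput, ← Finset.sum_add_distrib]
  exact Finset.sum_congr rfl fun i _ =>
    Finsupp.sum_add_index' (fun L => zero_smul ℝ _) fun L b₁ b₂ => add_smul b₁ b₂ _

lemma firOutput_smul (c : ℝ) (h : ι → ℤ →₀ ℝ) (k : ℤ) :
    firOutput μ x (c • h) k = c • firOutput μ x h k := by
  simp only [firOutput, Finset.smul_sum]
  refine Finset.sum_congr rfl fun i _ => ?_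
  rw [Pi.smul_apply, Finsupp.sum_smul_index (by simp), Finsupp.smul_sum]
  simp only [mul_smul]

lemma firOutput_single [DecidableEq ι] (i : ι) (L : ℤ) (k : ℤ) :
    firOutput μ x (Pi.single i (Finsupp.single L 1)) k = x i (k - L) := by
  rw [firOutput, Finset.sum_eq_single i]
  · rw [Pi.single_eq_same, Finsupp.sum_single_index (by simp), one_smul]
  · intro l _ hl
    rw [Pi.single_eq_of_ne hl, Finsupp.sum_zero_index]
  · simp

lemma firResponse_zero {κ : Type*} : firResponse (0 : κ → ℤ →₀ ℝ) = 0 := by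
  ext i ω
  simp [firResponse]

end Linear

variable {x : ι → ℤ → Lp ℝ 2 μ} {j : ι}

lemma mem_observedSpace {i : ι} (hi : i ≠ j) (k : ℤ) : x i k ∈ observedSpace μ x j :=
  Submodule.le_topologicalClosure _ (Submodule.subset_span ⟨i, hi, k, rfl⟩)

variable [DecidableEq ι]

/-- Taps of the prediction error filter. -/
def errorTaps (h : {i : ι // i ≠ j} → ℤ →₀ ℝ) : ι → ℤ →₀ ℝ :=
  extendAt j (Finsupp.single 0 1) ((-1 : ℝ) • h)

lemma firResponse_errorTaps (h : {i : ι // i ≠ j} → ℤ →₀ ℝ) (ω : ℝ) :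
    (fun i => firResponse (errorTaps h) i ω) = extendAt j 1 fun i => -firResponse h i ω := by
  ext i
  by_cases hi : i = j
  · subst hi
    rw [extendAt_self, firResponse, errorTaps, extendAt_self, Finsupp.sum_single_index (by simp)]
    simp
  · have h1 := extendAt_val j (Finsupp.single 0 1) ((-1 : ℝ) • h) ⟨i, hi⟩
    have h2 := extendAt_val j (1 : ℂ) (fun i => -firResponse h i ω) ⟨i, hi⟩
    simp only at h1 h2
    rw [h2, firResponse, errorTaps, h1, Pi.smul_apply, Finsupp.sum_smul_index (by simp),
      firResponse, Finsupp.sum, Finsupp.sum, ← Finset.sum_neg_distrib]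
    exact Finset.sum_congr rfl fun L _ => by push_cast; ring

variable [Fintype ι]

lemma firOutput_mem_observedSpace (h : {i : ι // i ≠ j} → ℤ →₀ ℝ) (k : ℤ) :
    firOutput μ (observed x j) h k ∈ observedSpace μ x j :=
  Submodule.sum_mem _ fun i _ => Submodule.sum_mem _ fun _ _ =>
    Submodule.smul_mem _ _ (mem_observedSpace i.2 _)

lemma exists_firOutput_eq_of_mem_span {v : Lp ℝ 2 μ} (k : ℤ)
    (hv : v ∈ Submodule.span ℝ {v | ∃ i, i ≠ j ∧ ∃ k, v = x i k}) :
    ∃ h, firOutput μ (observed x j) h k = v := by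
  induction hv using Submodule.span_induction with
  | mem v hv =>
    obtain ⟨i, hi, t, rfl⟩ := hv
    -- The output time k is fixed, so x_i(t) is reached by a unit tap at lag k - t.
    refine ⟨Pi.single ⟨i, hi⟩ (Finsupp.single (k - t) 1), ?_⟩
    rw [firOutput_single, sub_sub_cancel]
  | zero => exact ⟨0, by simp [firOutput]⟩
  | add u v _ _ hu hv =>
    obtain ⟨h, rfl⟩ := hu
    obtain ⟨h', rfl⟩ := hv
    exact ⟨h + h', firOutput_add _ _ _ _⟩
  | smul c v _ hv =>
    obtain ⟨h, rfl⟩ := hv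
    exact ⟨c • h, firOutput_smul _ _ _ _⟩

lemma firOutput_errorTaps (h : {i : ι // i ≠ j} → ℤ →₀ ℝ) (k : ℤ) :
    firOutput μ x (errorTaps h) k =
      x j k - firOutput μ (observed x j) h k := by
  rw [sub_eq_add_neg, ← neg_one_smul ℝ (firOutput μ _ h k), ← firOutput_smul, firOutput,
    Fintype.sum_eq_add_sum_subtype_ne _ j, errorTaps, extendAt_self,
    Finsupp.sum_single_index (by simp), one_smul, sub_zero]
  simp only [extendAt_val, firOutput]

/-! ### Wiener filters from a completed square -/

/-- At frequency `ω`, the spectral density of the sequences other than `j` is positive definite,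
and the error spectrum of a filter `V` is `(V - F) Φ (V - F)^*` plus the nonnegative `θ`. -/
structure CompletesSquareAt (x : ι → ℤ → Lp ℝ 2 μ) (j : ι) (F : {i : ι // i ≠ j} → ℝ → ℂ)
    (θ : ℝ → ℝ) (ω : ℝ) : Prop where
  nonneg : 0 ≤ θ ω
  re_nonneg : ∀ U, 0 ≤ (sesq (psd μ (observed x j) ω) U).re
  definite : ∀ U, (sesq (psd μ (observed x j) ω) U).re ≤ 0 → U = 0
  error : ∀ V : {i : ι // i ≠ j} → ℂ, sesq (psd μ x ω) (extendAt j 1 fun i => -V i) =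
    sesq (psd μ (observed x j) ω) (fun i => V i - F i ω) + θ ω

variable {F : {i : ι // i ≠ j} → ℝ → ℂ} {θ : ℝ → ℝ}

/-- The error is itself a finite filter output, so its mean square is an integral of `sesq`, and the
completed square splits the integrand. Working in `ENNReal` requires no prior integrability of F or
θ. -/
lemma ofReal_error_eq (hx : ∀ i l, Costationary (x i) (x l)) (hm : ∀ i, Measurable (F i))
    (hsq : ∀ᵐ ω ∂(volume.restrict (Set.Ioc (-π) π)), CompletesSquareAt x j F θ ω)
    (h : {i : ι // i ≠ j} → ℤ →₀ ℝ) (k : ℤ) :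
    ENNReal.ofReal (2 * π *
        ‖x j k - firOutput μ (observed x j) h k‖ ^ 2) =
      spectralDistSq μ (observed x j) (firResponse h) F +
        ∫⁻ ω in Set.Ioc (-π) π, ENNReal.ofReal (θ ω) := by
  have hcont : Continuous fun ω =>
      (sesq (psd μ x ω) fun i => firResponse (errorTaps h) i ω).re := by
    refine Complex.continuous_re.comp (continuous_finsetSum _ fun i _ =>
      continuous_finsetSum _ fun l _ => ?_)
    exact ((continuous_firResponse _ i).mul (continuous_psd hx i l)).mul
      (Complex.continuous_conj.comp (continuous_firResponse _ l))
  have herr : ∀ᵐ ω ∂(volume.restrict (Set.Ioc (-π) π)),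
      (sesq (psd μ x ω) fun i => firResponse (errorTaps h) i ω).re =
        (sesq (psd μ (observed x j) ω)
          fun i => firResponse h i ω - F i ω).re + θ ω := by
    filter_upwards [hsq] with ω hω
    rw [firResponse_errorTaps, hω.error, Complex.add_re, Complex.ofReal_re]
  rw [← firOutput_errorTaps, ← integral_sesq_firResponse hx, ofReal_integral_eq_lintegral_ofReal
    (hcont.integrableOn_Icc.mono_set Set.Ioc_subset_Icc_self), spectralDistSq_eq,
    ← lintegral_add_left']
  · refine lintegral_congr_ae ?_
    filter_upwards [hsq, herr] with ω hω he
    rw [he, ENNReal.ofReal_add (hω.re_nonneg _) hω.nonneg]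
  · exact aemeasurable_re_sesq (U := fun i ω => firResponse h i ω - F i ω) (costationary_observed hx j)
      fun i => ((continuous_firResponse _ i).measurable.sub (hm i)).aemeasurable
  · filter_upwards [hsq, herr] with ω hω he
    rw [he]
    exact add_nonneg (hω.re_nonneg _) hω.nonneg

/-- For the zero filter the error is x_j itself, of finite mean square, so both summands are finite.
-/
lemma lintegral_error_ne_top (hx : ∀ i l, Costationary (x i) (x l)) (hm : ∀ i, Measurable (F i))
    (hsq : ∀ᵐ ω ∂(volume.restrict (Set.Ioc (-π) π)), CompletesSquareAt x j F θ ω) :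
    spectralDistSq μ (observed x j) 0 F ≠ ⊤ ∧
      ∫⁻ ω in Set.Ioc (-π) π, ENNReal.ofReal (θ ω) ≠ ⊤ := by
  have h := ofReal_error_eq hx hm hsq 0 0
  rw [firResponse_zero] at h
  exact ENNReal.add_ne_top.1 (h ▸ ENNReal.ofReal_ne_top)

/-- The bound holds for finite filter outputs, which exhaust the span, and it is a closed condition
on q. -/
lemma lintegral_error_le (hx : ∀ i l, Costationary (x i) (x l)) (hm : ∀ i, Measurable (F i))
    (hsq : ∀ᵐ ω ∂(volume.restrict (Set.Ioc (-π) π)), CompletesSquareAt x j F θ ω)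
    (k : ℤ) {q : Lp ℝ 2 μ} (hq : q ∈ observedSpace μ x j) :
    ∫⁻ ω in Set.Ioc (-π) π, ENNReal.ofReal (θ ω) ≤
      ENNReal.ofReal (2 * π * ‖x j k - q‖ ^ 2) := by
  have hcl : IsClosed {q : Lp ℝ 2 μ | ∫⁻ ω in Set.Ioc (-π) π, ENNReal.ofReal (θ ω) ≤
      ENNReal.ofReal (2 * π * ‖x j k - q‖ ^ 2)} :=
    isClosed_le continuous_const (ENNReal.continuous_ofReal.comp (by fun_prop))
  refine closure_minimal (fun v hv => ?_) hcl hq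
  obtain ⟨h, rfl⟩ := exists_firOutput_eq_of_mem_span k hv
  rw [Set.mem_ofPred_eq, ofReal_error_eq hx hm hsq]
  exact le_add_self

lemma exists_fir_tendsto_of_completesSquare (hx : ∀ i l, Costationary (x i) (x l))
    (hm : ∀ i, Measurable (F i)) (hper : ∀ i, Function.Periodic (F i) (2 * π))
    (hsymm : ∀ i ω, F i (-ω) = (starRingEnd ℂ) (F i ω))
    (hsq : ∀ᵐ ω ∂(volume.restrict (Set.Ioc (-π) π)), CompletesSquareAt x j F θ ω) :
    ∃ g : ℕ → {i : ι // i ≠ j} → ℤ →₀ ℝ, Tendsto (fun m => spectralDistSq μ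
      (observed x j) (firResponse (g m)) F) atTop (𝓝 0) :=
  exists_fir_tendsto (costationary_observed hx j) (hsq.mono fun _ h => h.re_nonneg) hm hper hsymm
    (lintegral_error_ne_top hx hm hsq).1

theorem exists_isWienerFilter (hx : ∀ i l, Costationary (x i) (x l))
    (hm : ∀ i, Measurable (F i)) (hper : ∀ i, Function.Periodic (F i) (2 * π))
    (hsymm : ∀ i ω, F i (-ω) = (starRingEnd ℂ) (F i ω))
    (hsq : ∀ᵐ ω ∂(volume.restrict (Set.Ioc (-π) π)), CompletesSquareAt x j F θ ω) :
    IsWienerFilter μ x j F := by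
  set K := observedSpace μ x j with hK
  have : CompleteSpace K :=
    (Submodule.isClosed_topologicalClosure _).completeSpace_coe
  have hpyth : ∀ k, ∀ q ∈ K, ‖x j k - q‖ ^ 2 =
      ‖x j k - K.starProjection (x j k)‖ ^ 2 + ‖K.starProjection (x j k) - q‖ ^ 2 := by
    intro k q hq
    have h0 : inner ℝ (x j k - K.starProjection (x j k)) (K.starProjection (x j k) - q) = 0 :=
      K.starProjection_inner_eq_zero (x j k) _
        (K.sub_mem (K.starProjection_apply_mem _) hq)
    rw [← sub_add_sub_cancel (x j k) (K.starProjection (x j k)) q, sq, sq, sq,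
      norm_add_sq_eq_norm_sq_add_norm_sq_of_inner_eq_zero _ _ h0]
  refine ⟨fun k => K.starProjection (x j k), fun k => ⟨K.starProjection_apply_mem _, ?_⟩,
    fun i => (hm i).aemeasurable, ?_⟩
  · intro q hq
    rw [← norm_sub_sq_eq_integral, ← norm_sub_sq_eq_integral, hpyth k q hq]
    exact le_add_of_nonneg_right (sq_nonneg _)
  · obtain ⟨g, hg⟩ := exists_fir_tendsto_of_completesSquare hx hm hper hsymm hsq
    refine ⟨g, hg, fun k => ?_⟩
    -- By Pythagoras the error of an approximant is the projection error plus its squared distance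
    -- to the projection. The projection error is at least the constant, so that distance is at most
    -- the excess, which is the spectral distance to F.
    have hle : ∀ m, ENNReal.ofReal (2 * π * ‖K.starProjection (x j k) -
        firOutput μ (observed x j) (g m) k‖ ^ 2) ≤
        spectralDistSq μ (observed x j) (firResponse (g m)) F := by
      intro m
      have h1 := ofReal_error_eq hx hm hsq (g m) k
      rw [hpyth k _ (firOutput_mem_observedSpace (g m) k), mul_add,
        ENNReal.ofReal_add (by positivity) (by positivity), add_comm] at h1
      have h2 := lintegral_error_le hx hm hsq k (K.starProjection_apply_mem (x j k))
      refine (ENNReal.add_le_add_iff_right ENNReal.ofReal_ne_top).1 (h1.le.trans ?_)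
      gcongr
    have h0 : Tendsto (fun m => ENNReal.ofReal (2 * π * ‖K.starProjection (x j k) -
        firOutput μ (observed x j) (g m) k‖ ^ 2)) atTop (𝓝 0) :=
      tendsto_of_tendsto_of_tendsto_of_le_of_le tendsto_const_nhds hg (fun m => zero_le) hle
    have h3 := (ENNReal.tendsto_toReal ENNReal.zero_ne_top).comp h0
    have h4 : Tendsto (fun m => ‖K.starProjection (x j k) -
        firOutput μ (observed x j) (g m) k‖) atTop (𝓝 0) := by
      have h5 := ((h3.const_mul (2 * π)⁻¹).sqrt)
      rw [ENNReal.toReal_zero, mul_zero, sqrt_zero] at h5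
      refine h5.congr fun m => ?_
      rw [Function.comp_apply, ENNReal.toReal_ofReal (by positivity), ← mul_assoc,
        inv_mul_cancel₀ two_pi_pos.ne', one_mul, sqrt_sq (norm_nonneg _)]
    rw [tendsto_iff_norm_sub_tendsto_zero]
    exact h4.congr fun m => norm_sub_rev _ _

/-- The finite filters defining W have errors tending to that of y, which is at most the constant c;
the error identity then forces their distance to F to 0. They also tend to W, so W and F are at
distance 0. -/
theorem ae_eq_of_isWienerFilter (hx : ∀ i l, Costationary (x i) (x l))
    (hm : ∀ i, Measurable (F i)) (hper : ∀ i, Function.Periodic (F i) (2 * π))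
    (hsymm : ∀ i ω, F i (-ω) = (starRingEnd ℂ) (F i ω))
    (hsq : ∀ᵐ ω ∂(volume.restrict (Set.Ioc (-π) π)), CompletesSquareAt x j F θ ω)
    {W : {i : ι // i ≠ j} → ℝ → ℂ} (hW : IsWienerFilter μ x j W) :
    ∀ᵐ ω ∂(volume.restrict (Set.Ioc (-π) π)), ∀ i, W i ω = F i ω := by
  obtain ⟨y, hy, hWm, h, hhW, hhy⟩ := hW
  obtain ⟨g, hg⟩ := exists_fir_tendsto_of_completesSquare hx hm hper hsymm hsq
  have hfin := (lintegral_error_ne_top hx hm hsq).2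
  have hid := ofReal_error_eq hx hm hsq
  set c := ∫⁻ ω in Set.Ioc (-π) π, ENNReal.ofReal (θ ω)
  have hmin : ENNReal.ofReal (2 * π * ‖x j 0 - y 0‖ ^ 2) ≤ c := by
    have hlim : Tendsto (fun m => spectralDistSq μ (observed x j)
        (firResponse (g m)) F + c) atTop (𝓝 c) := by
      simpa using hg.add_const c
    refine ge_of_tendsto' hlim fun m => ?_
    rw [← hid (g m) 0]
    refine ENNReal.ofReal_le_ofReal (mul_le_mul_of_nonneg_left ?_ two_pi_pos.le)
    rw [norm_sub_sq_eq_integral, norm_sub_sq_eq_integral]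
    exact (hy 0).2 _ (firOutput_mem_observedSpace (g m) 0)
  have hhF : Tendsto (fun m => spectralDistSq μ (observed x j)
      (firResponse (h m)) F) atTop (𝓝 0) := by
    have h1 : Tendsto (fun m => ENNReal.ofReal (2 * π * ‖x j 0 -
        firOutput μ (observed x j) (h m) 0‖ ^ 2)) atTop
        (𝓝 (ENNReal.ofReal (2 * π * ‖x j 0 - y 0‖ ^ 2))) :=
      ENNReal.tendsto_ofReal ((((hhy 0).const_sub (x j 0)).norm.pow 2).const_mul (2 * π))
    simp only [hid] at h1
    -- Subtraction truncates at 0, so the upper bound `hmin` alone gives the limit 0.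
    have h2 := ENNReal.Tendsto.sub h1 (tendsto_const_nhds (x := c)) (Or.inr hfin)
    rw [tsub_eq_zero_of_le hmin] at h2
    exact h2.congr fun m => ENNReal.add_sub_cancel_right hfin
  have hzero : spectralDistSq μ (observed x j) W F = 0 := by
    have hlim := (ENNReal.Tendsto.const_mul (a := 2) hhW (Or.inr ENNReal.ofNat_ne_top)).add
      (ENNReal.Tendsto.const_mul (a := 2) hhF (Or.inr ENNReal.ofNat_ne_top))
    rw [mul_zero, add_zero] at hlim
    refine le_antisymm (ge_of_tendsto' hlim fun m => ?_) zero_le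
    rw [spectralDistSq_comm _ (firResponse (h m)) W]
    exact spectralDistSq_le (costationary_observed hx j) (hsq.mono fun _ h => h.re_nonneg) F hWm
      fun i => (continuous_firResponse _ i).measurable.aemeasurable
  rw [spectralDistSq_eq, lintegral_eq_zero_iff' (aemeasurable_re_sesq
    (U := fun i ω => W i ω - F i ω) (costationary_observed hx j)
    fun i => (hWm i).sub (hm i).aemeasurable)] at hzero
  filter_upwards [hzero, hsq] with ω h0 hω i
  have := hω.definite _ (ENNReal.ofReal_eq_zero.1 h0)
  exact sub_eq_zero.1 (congrFun this i)

end Observed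

/-! ### Regularity of the filter formulas -/

namespace Network

variable {n : ℕ} (D : Network n)

lemma exp_I_mul_periodic (ω : ℝ) :
    Complex.exp (Complex.I * ((ω + 2 * π : ℝ) : ℂ)) = Complex.exp (Complex.I * ω) := by
  rw [Complex.exp_eq_exp_iff_exists_int]
  exact ⟨1, by push_cast; ring⟩

lemma exp_I_mul_neg (ω : ℝ) :
    Complex.exp (Complex.I * ((-ω : ℝ) : ℂ)) =
      (starRingEnd ℂ) (Complex.exp (Complex.I * ω)) := by
  rw [← Complex.exp_conj]
  simp

lemma S_conj (i : Fin n) (z : ℂ) : D.S i ((starRingEnd ℂ) z) = (starRingEnd ℂ) (D.S i z) := by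
  simp [S, Complex.conj_ofNat]

lemma measurable_S (i : Fin n) : Measurable (D.S i) := by
  unfold S
  fun_prop

variable {Ω : Type*} [MeasurableSpace Ω] {μ : Measure Ω} {p : Fin n → ℤ → Lp ℝ 2 μ}

/-- The sum of the child, parent and spouse terms. -/
def wienerFormula (D : Network n) (μ : Measure Ω) (p : Fin n → ℤ → Lp ℝ 2 μ) (j i : Fin n)
    (ω : ℝ) : ℂ :=
  D.childTerm μ p j i ω + D.parentTerm μ p j i ω + D.spouseTerm μ p j i ω

/-- The error spectrum of the optimal filter. -/
def minimalErrorDensity (D : Network n) (μ : Measure Ω) (p : Fin n → ℤ → Lp ℝ 2 μ) (j : Fin n)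
    (ω : ℝ) : ℝ :=
  (factorDiag (D.dynMatrix (Complex.exp (Complex.I * ω))) (fun i => (psd μ p ω i i).re) j)⁻¹

lemma measurable_wienerFormula (hp : ∀ i l, Costationary (p i) (p l)) (j i : Fin n) :
    Measurable (D.wienerFormula μ p j i) := by
  have h1 : ∀ k, Measurable fun ω => psd μ p ω k k := fun k => (continuous_psd hp k k).measurable
  have h2 : ∀ k, Measurable fun ω : ℝ => D.S k (Complex.exp (Complex.I * ω)) := fun k =>
    (D.measurable_S k).comp (by fun_prop)
  unfold wienerFormula childTerm parentTerm spouseTerm denom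
  fun_prop

lemma wienerFormula_periodic (j i : Fin n) :
    Function.Periodic (D.wienerFormula μ p j i) (2 * π) := by
  intro ω
  have h : ∀ k, psd μ p (ω + 2 * π) k k = psd μ p ω k k := fun k => psd_periodic p k k ω
  simp only [wienerFormula, childTerm, parentTerm, spouseTerm, denom, h, exp_I_mul_periodic]

lemma wienerFormula_neg (j i : Fin n) (ω : ℝ) :
    D.wienerFormula μ p j i (-ω) = (starRingEnd ℂ) (D.wienerFormula μ p j i ω) := by
  simp only [wienerFormula, childTerm, parentTerm, spouseTerm, denom, psd_neg, exp_I_mul_neg,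
    S_conj, RCLike.norm_conj, map_add, map_div₀, map_mul, map_sum, map_neg, map_inv₀, map_pow,
    Complex.conj_ofReal]

variable {x : Fin n → ℤ → Lp ℝ 2 μ}

lemma Satisfies.completesSquareAt {D : Network n} (h : D.Satisfies x p)
    (hx : ∀ i l, Costationary (x i) (x l)) (hp : ∀ i l, Costationary (p i) (p l))
    (huncorr : ∀ i l, i ≠ l → ∀ s t, ∫ w, p i s w * p l t w ∂μ = 0) (j : Fin n) {ω : ℝ}
    (hω : 1 + Complex.exp (-(Complex.I * ω)) ≠ 0) (hpos : ∀ i, 0 < (psd μ p ω i i).re) :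
    CompletesSquareAt x j (fun i => D.wienerFormula μ p j i) (D.minimalErrorDensity μ p j) ω := by
  have hf := h.factor hx hp huncorr hω
  have hM := isUnit_det_of_factor hpos hf
  have hrestrict : ∀ U : {i : Fin n // i ≠ j} → ℂ,
      sesq (psd μ x ω) (extendAt j 0 U) =
        sesq (psd μ (observed x j) ω) U := by
    intro U
    rw [sesq_eq_sesq_submatrix _ (extendAt_self j 0 U)]
    simp only [extendAt_val]
    rfl
  refine ⟨inv_nonneg.2 (factorDiag_pos hpos hM j).le, fun U => ?_, fun U hU => ?_, fun V => ?_⟩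
  · rw [← hrestrict]
    exact re_sesq_nonneg_of_factor hpos hf _
  · rw [← hrestrict] at hU
    have h0 := eq_zero_of_re_sesq_nonpos hpos hf hU
    ext i
    rw [← extendAt_val j 0 U i, h0]
    rfl
  -- Both vectors equal 1 at j, so their difference vanishes there and the form reduces to the
  -- observed spectrum; the sign change turns -V + F into V - F.
  · rw [sesq_eq_add_of_factor hpos hf j (extendAt_self j 1 _), ← hrestrict, ← sesq_neg]
    congr 2
    ext i
    by_cases hi : i = j
    · subst hi
      simp [factorRow_self hpos hM]
    · have h1 := extendAt_val j (1 : ℂ) (fun i => -V i) ⟨i, hi⟩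
      have h2 := extendAt_val j (0 : ℂ) (fun i => V i - D.wienerFormula μ p j i ω) ⟨i, hi⟩
      simp only at h1 h2
      rw [h2, Pi.neg_apply, Pi.sub_apply, h1, D.factorRow_dynMatrix hp hi, wienerFormula]
      ring

end Network

end WienerNet

end

theorem theorem2 {Ω : Type*} [MeasurableSpace Ω] (μ : Measure Ω) [IsProbabilityMeasure μ]
    {n : ℕ} (D : WienerNet.Network n) (x p : Fin n → ℤ → Lp ℝ 2 μ)
    (hp_mean : ∀ i k, ∫ w, p i k w ∂μ = 0)
    (hp_wss : WienerNet.JointlyWSS μ p)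
    (hp_uncorr : ∀ i j, i ≠ j → ∀ s t, ∫ w, p i s w * p j t w ∂μ = 0)
    (hp_sum : WienerNet.SummableCorr μ p)
    (hp_pos : ∀ᵐ ω ∂(volume.restrict (Set.Ioc (-π) π)), ∀ i, 0 < (WienerNet.psd μ p ω i i).re)
    (hx_wss : WienerNet.JointlyWSS μ x)
    (hx_sum : WienerNet.SummableCorr μ x)
    (hdyn : D.Satisfies x p)
    (j : Fin n) :
    (∃ W, WienerNet.IsWienerFilter μ x j W) ∧
    (∀ W, WienerNet.IsWienerFilter μ x j W →
      ∀ᵐ ω ∂(volume.restrict (Set.Ioc (-π) π)), ∀ (i : Fin n) (hij : i ≠ j),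
        W ⟨i, hij⟩ ω =
          D.childTerm μ p j i ω + D.parentTerm μ p j i ω + D.spouseTerm μ p j i ω) ∧
    (∀ᵐ ω ∂(volume.restrict (Set.Ioc (-π) π)),
      ∃ d : ℝ, 0 < d ∧ D.denom μ p (D.neighbors j) j ω = (d : ℂ)) ∧
    (D.children j ⊆ D.parents j →
      ∀ ω, D.denom μ p (D.parents j) j ω = D.denom μ p (D.neighbors j) j ω) := by
  have hx := WienerNet.costationary_of_wss hx_wss hx_sum
  have hp := WienerNet.costationary_of_wss hp_wss hp_sum
  have hne := WienerNet.Network.one_add_exp_ne_zero_ae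
  have hsq : ∀ᵐ ω ∂(volume.restrict (Set.Ioc (-π) π)), WienerNet.CompletesSquareAt x j
      (fun i => D.wienerFormula μ p j i) (D.minimalErrorDensity μ p j) ω := by
    filter_upwards [hne, hp_pos] with ω h1 h2
    exact hdyn.completesSquareAt hx hp hp_uncorr j h1 h2
  have hm := fun i : {i : Fin n // i ≠ j} => D.measurable_wienerFormula hp j i
  have hper := fun i : {i : Fin n // i ≠ j} => D.wienerFormula_periodic (μ := μ) (p := p) j i
  have hneg := fun i : {i : Fin n // i ≠ j} => D.wienerFormula_neg (μ := μ) (p := p) j i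
  refine ⟨⟨_, WienerNet.exists_isWienerFilter hx hm hper hneg hsq⟩, fun W hW => ?_, ?_,
    fun h ω => by rw [D.parents_eq_neighbors h]⟩
  · filter_upwards [WienerNet.ae_eq_of_isWienerFilter hx hm hper hneg hsq hW] with ω hω i hij
    exact hω ⟨i, hij⟩
  · filter_upwards [hne, hp_pos] with ω h1 h2
    exact ⟨_, WienerNet.factorDiag_pos h2 (WienerNet.isUnit_det_of_factor h2
      (hdyn.factor hx hp hp_uncorr h1)) j, (D.factorDiag_dynMatrix hp j ω).symm⟩
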